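/- Let $N\ge 1$. Take $2N$ ideal hyperbolic triangles, label their sides by $1,\dots,6N$ so that $3i-2,3i-1,3i$ are the sides of the $i$-th triangle in cyclic (counterclockwise) order, choose uniformly at random a partition $\omega$ of $\{1,\dots,6N\}$ into pairs, and glue the paired sides (with shear $0$, compatibly with the orientations of the triangles). Let $S_O(\omega)$ be the resulting oriented, possibly disconnected, cusped surface. A free homotopy class of closed curves on $S_O(\omega)$ that is represented by a curve passing through the triangles without ever leaving a triangle through the side by which it entered determines a nonempty word in the letters $L$ and $R$, which records whether the curve turns left or right in the successive triangles. This word is determined up to cyclic permutation of its letters and, when the direction of the curve is reversed, up to reading it backwards with $L$ and $R$ interchanged. Let $\sim$ be the equivalence relation on nonempty words generated by these two operations, let $[w]$ be the class of $w$, $|[w]|$ its cardinality and $|w|$ the number of letters of $w$. Let $Z_{[w],N}(\omega)$ be the number of primitive unoriented free homotopy classes of closed curves on $S_O(\omega)$ whose word belongs to $[w]$ (primitive: not the class of a closed curve run through $k\ge2$ times; classes of curves around cusps are included). Let $W$ be a finite set of classes of nonempty words, let $m_W=\max\{|w| : [w]\in W\}$ (with $m_W=0$ if $W=\emptyset$),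 and assume $m_W\le N$. Let $\mathbf Z_{W,N}=(Z_{[w],N})_{[w]\in W}$, and let $\mathbf Z_W=(Z_{[w]})_{[w]\in W}$ be a vector of independent Poisson random variables, $Z_{[w]}$ having mean $\frac{|[w]|}{2|w|}$. Then $$ d_{mTV}(\mathbf Z_{W,N},\mathbf Z_W):=\sup_{B\subseteq \mathbb N_0^{W}}\big|\mathbb P[\mathbf Z_{W,N}\in B]-\mathbb P[\mathbf Z_W\in B]\big|\;\le\; 18\,|W|^3\,(6m_W)^{3m_W+4}\,\frac1N . $$ -/

import Mathlib

open MeasureTheory ProbabilityTheory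

/-! ### Words in the letters `L` and `R` -/

/-- The two letters: a left turn and a right turn. -/
inductive Letter where
  | L : Letter
  | R : Letter
  deriving DecidableEq

/-- Interchange of the two letters. -/
def Letter.swap : Letter → Letter
  | .L => .R
  | .R => .L

theorem Letter.swap_swap (a : Letter) : a.swap.swap = a := by
  cases a <;> rfl

/-- Nonempty words in `L` and `R`. -/
abbrev Word : Type := {w : List Letter // w ≠ []}

/-- The word read backwards with `L` and `R` interchanged. -/
def flipWord (w : List Letter) : List Letter := (w.map Letter.swap).reverse

theorem flipWord_flipWord (w : List Letter) : flipWord (flipWord w) = w := by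
  simp [flipWord, List.map_reverse, Function.comp_def, Letter.swap_swap]

theorem flipWord_isRotated {v w : List Letter} (h : v ~r w) : flipWord v ~r flipWord w :=
  (h.map Letter.swap).reverse

/-- Two words are equivalent if they agree up to cyclic permutation of the letters and up to
reading backwards with `L` and `R` interchanged. -/
instance wordSetoid : Setoid Word where
  r v w := v.1 ~r w.1 ∨ flipWord v.1 ~r w.1
  iseqv :=
    { refl := fun v => Or.inl (List.IsRotated.refl v.1)
      symm := by
        rintro v w (h | h)
        · exact Or.inl h.symm
        · refine Or.inr ?_
          have := flipWord_isRotated h.symm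
          rwa [flipWord_flipWord] at this
      trans := by
        rintro u v w (h | h) (k | k)
        · exact Or.inl (h.trans k)
        · exact Or.inr ((flipWord_isRotated h).trans k)
        · exact Or.inr (h.trans k)
        · refine Or.inl ?_
          have := flipWord_isRotated h
          rw [flipWord_flipWord] at this
          exact this.trans k }

/-- Equivalence classes `[w]` of words. -/
abbrev WordClass : Type := Quotient wordSetoid

/-- The length `|w|` of any representative `w` of the class. -/
def WordClass.length : WordClass → ℕ :=
  Quotient.lift (fun w : Word => w.1.length) (by
    rintro v w (h | h)
    · exact h.perm.length_eq
    · simpa [flipWord] using h.perm.length_eq)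

/-- The cardinality of the class, that is, the number of words in it. -/
noncomputable def WordClass.card (c : WordClass) : ℕ :=
  Set.ncard {w : Word | (⟦w⟧ : WordClass) = c}

/-- The mean `|[w]| / (2 |w|)`. -/
noncomputable def WordClass.mean (c : WordClass) : NNReal :=
  (c.card : NNReal) / (2 * (c.length : NNReal))

/-- The maximal length of a word in `W` (`0` if `W` is empty). -/
def maxLength (W : Finset WordClass) : ℕ := W.sup WordClass.length

/-! ### Random gluings of `2N` ideal triangles -/

/-- The sides of `2N` triangles. The side `(i, j)` is the side number `j` of the triangle number
`i`; it stands for the label `3i + j + 1` in `{1, …, 6N}`. The sides of each triangle are ordered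
cyclically `(i, 0), (i, 1), (i, 2)`, counterclockwise with respect to the orientation of the
surface. -/
abbrev Side (N : ℕ) : Type := Fin (2 * N) × Fin 3

/-- The triangle to which a side belongs. -/
def Side.triangle {N : ℕ} (s : Side N) : Fin (2 * N) := s.1

/-- Partitions of the set of the `6N` sides into pairs, each given by the map that sends a side to
the side it is paired with: an involution without fixed points. Paired sides are glued to each
other, compatibly with the orientations of the triangles. -/
abbrev Gluing (N : ℕ) : Type :=
  {σ : Equiv.Perm (Side N) // ∀ s, σ (σ s) = s ∧ σ s ≠ s}

instance (N : ℕ) : MeasurableSpace (Gluing N) := ⊤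

/-- The uniform probability measure on the finite set of all gluings. -/
noncomputable def gluingMeasure (N : ℕ) : Measure (Gluing N) := uniformOn Set.univ

/-! ### Closed curves on the glued surface

The cusped surface of a gluing `ω` is decomposed into contractible pieces, the ideal triangles,
which meet along contractible sides and have no vertices. A closed curve is therefore recorded, up
to homotopy, by the cyclic list `x₁, …, x_k` of the sides through which it leaves the successive
triangles: having left a triangle through `x_i`, it enters the next triangle through `ω x_i`, and
it leaves that one through `x_{i+1}`. Free homotopy is generated by removing (or inserting) an
excursion across a side and straight back, and by the choice of the starting point. -/

/-- The list of sides crossed by a closed curve: the side through which the curve enters a triangle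
and the side through which it leaves it next belong to the same triangle, cyclically. -/
def IsClosedCurve {N : ℕ} (ω : Gluing N) (l : List (Side N)) : Prop :=
  ∀ p ∈ l.zip (l.rotate 1), (ω.1 p.1).triangle = p.2.triangle

/-- Closed curves, as cyclic sequences of crossings of sides. (The empty list stands for all
constant curves.) -/
abbrev ClosedCurve {N : ℕ} (ω : Gluing N) : Type := {l : List (Side N) // IsClosedCurve ω l}

/-- The elementary moves that generate free homotopy of closed curves without orientation. -/
inductive CurveMove {N : ℕ} (ω : Gluing N) : ClosedCurve ω → ClosedCurve ω → Prop
  /-- change of the starting point -/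
  | rotate (γ δ : ClosedCurve ω) (n : ℕ) (h : δ.1 = γ.1.rotate n) : CurveMove ω γ δ
  /-- removal of a crossing of the side `x` that is followed by crossing it straight back -/
  | backtrack (γ δ : ClosedCurve ω) (p q : List (Side N)) (x : Side N)
      (hγ : γ.1 = p ++ x :: ω.1 x :: q) (hδ : δ.1 = p ++ q) : CurveMove ω γ δ
  /-- the same curve with the opposite orientation -/
  | reverse (γ δ : ClosedCurve ω) (h : δ.1 = (γ.1.map ω.1).reverse) : CurveMove ω γ δ

/-- Free homotopy of closed curves, disregarding orientation. -/
instance homotopySetoid {N : ℕ} (ω : Gluing N) : Setoid (ClosedCurve ω) :=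
  Relation.EqvGen.setoid (CurveMove ω)

/-- Free homotopy classes of closed curves without orientation. -/
abbrev HomotopyClass {N : ℕ} (ω : Gluing N) : Type := Quotient (homotopySetoid ω)

/-- A homotopy class is primitive if it is not the class of a curve run through `k ≥ 2` times.
(The class of the constant curves is not primitive.) -/
def HomotopyClass.IsPrimitive {N : ℕ} {ω : Gluing N} (c : HomotopyClass ω) : Prop :=
  ¬ ∃ (γ δ : ClosedCurve ω) (k : ℕ),
    2 ≤ k ∧ δ.1 = (List.replicate k γ.1).flatten ∧ (⟦δ⟧ : HomotopyClass ω) = c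

/-- The side through which a curve leaves a triangle that it entered through the side `a`, if it
turns left or right, respectively. Counterclockwise from the side `a` the next side is the one to
the right and the one after it is the one to the left. -/
def turnFrom {N : ℕ} : Letter → Side N → Side N
  | .R, a => (a.1, a.2 + 1)
  | .L, a => (a.1, a.2 + 2)

/-- The curve that crosses the sides in the list `l` traces the word `w`: having crossed the
`i`-th side, it turns according to the `i`-th letter. In particular it never turns back. -/
def Traces {N : ℕ} (ω : Gluing N) (l : List (Side N)) (w : List Letter) : Prop :=
  l.length = w.length ∧ l.rotate 1 = List.zipWith (fun a x => turnFrom a (ω.1 x)) w l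

/-- The number of primitive free homotopy classes of closed curves of the combinatorial type
`c = [w]`: the classes with a representative that traces a word in `c`. -/
noncomputable def geodesicCount {N : ℕ} (c : WordClass) (ω : Gluing N) : ℕ :=
  Set.ncard {h : HomotopyClass ω | h.IsPrimitive ∧
    ∃ (γ : ClosedCurve ω) (w : Word),
      (⟦γ⟧ : HomotopyClass ω) = h ∧ (⟦w⟧ : WordClass) = c ∧ Traces ω γ.1 w.1}

/-- The random vector of the counts of the types in `W`. -/
noncomputable def countVector (W : Finset WordClass) (N : ℕ) (ω : Gluing N) : W → ℕ :=
  fun c => geodesicCount c.1 ω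

/-- The joint law of independent Poisson variables, indexed by `W`, with means `|[w]| / (2 |w|)`. -/
noncomputable def poissonVector (W : Finset WordClass) : Measure (W → ℕ) :=
  Measure.pi fun c : W => poissonMeasure c.1.mean

/-- The multivariate total variation distance of two laws on `ℕ^ι`. -/
noncomputable def dmTV {ι : Type*} (μ ν : Measure (ι → ℕ)) : ℝ :=
  ⨆ B : Set (ι → ℕ), |μ.real B - ν.real B|

/-! ### The Chen–Stein equation -/

theorem two_pow_le_factorial_succ (i : ℕ) : 2 ^ i ≤ (i + 1).factorial := by
  induction i with
  | zero => simp
  | succ i ih => rw [Nat.factorial_succ, pow_succ]; nlinarith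

theorem two_pow_mul_factorial_le (j i : ℕ) : 2 ^ i * j.factorial ≤ (j + 1 + i).factorial := by
  have h := Nat.le_of_dvd (Nat.factorial_pos _)
    (Nat.factorial_mul_factorial_dvd_factorial_add j (i + 1))
  rw [show j + 1 + i = j + (i + 1) by ring]
  calc 2 ^ i * j.factorial ≤ (i + 1).factorial * j.factorial :=
        Nat.mul_le_mul_right _ (two_pow_le_factorial_succ i)
    _ = j.factorial * (i + 1).factorial := mul_comm _ _
    _ ≤ _ := h

/-- Bounded solutions of the Chen–Stein equation for the Poisson distribution of mean at most `1`. -/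
theorem exists_chenStein_solution (r : NNReal) (hr : r ≤ 1) (f : ℕ → ℝ)
    (hf : ∀ n, 0 ≤ f n ∧ f n ≤ 1) :
    ∃ g : ℕ → ℝ, (∀ n, |g n| ≤ 2) ∧
      ∀ j : ℕ, (r : ℝ) * g (j + 1) - j * g j = f j - ∫ q, f q ∂poissonMeasure r := by
  set E := ∫ q, f q ∂poissonMeasure r with hE
  have hr0 : (0 : ℝ) ≤ r := r.2
  have hr1 : (r : ℝ) ≤ 1 := by exact_mod_cast hr
  have hint : Integrable f (poissonMeasure r) :=
    Integrable.of_bound (Measurable.of_discrete.aestronglyMeasurable) 1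
      (Filter.Eventually.of_forall fun n => by
        rw [Real.norm_eq_abs, abs_le]; constructor <;> linarith [(hf n).1, (hf n).2])
  have hE0 : 0 ≤ E := integral_nonneg fun n => (hf n).1
  have hE1 : E ≤ 1 := by
    have := integral_mono hint (integrable_const (1 : ℝ)) fun n => (hf n).2
    simpa using this
  set h : ℕ → ℝ := fun n => f n - E with hh
  have hh1 : ∀ n, |h n| ≤ 1 := fun n => by
    rw [abs_le]; constructor <;> simp only [hh] <;> linarith [(hf n).1, (hf n).2]
  have hzero : HasSum (fun n : ℕ => h n * (r : ℝ) ^ n / (n.factorial : ℝ)) 0 := by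
    have h1 := hasSum_integral_poissonMeasure hint
    have h2 := (hasSum_one_poissonMeasure r).mul_right E
    have h3 := (h1.sub h2).mul_left (Real.exp r)
    simp only [smul_eq_mul] at h3
    rw [← hE, one_mul, sub_self, mul_zero] at h3
    have hexp : Real.exp (r : ℝ) * Real.exp (-r) = 1 := by rw [← Real.exp_add]; simp
    refine (congrArg (HasSum · 0) (funext fun n => ?_)).mpr h3
    change (f n - E) * (r : ℝ) ^ n / (n.factorial : ℝ) = _
    linear_combination (-(f n - E) * (r : ℝ) ^ n / (n.factorial : ℝ)) * hexp
  let T : ℕ → ℕ → ℝ := fun j i =>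
    h (j + 1 + i) * (r : ℝ) ^ i * (j.factorial : ℝ) / ((j + 1 + i).factorial : ℝ)
  have hT : ∀ j i, ‖T j i‖ ≤ (1 / 2 : ℝ) ^ i := by
    intro j i
    have hpos : (0 : ℝ) < ((j + 1 + i).factorial : ℝ) := by positivity
    have h2 : (2 : ℝ) ^ i * (j.factorial : ℝ) ≤ ((j + 1 + i).factorial : ℝ) := by
      exact_mod_cast two_pow_mul_factorial_le j i
    have h3 : |h (j + 1 + i) * (r : ℝ) ^ i| ≤ 1 := by
      rw [abs_mul, abs_of_nonneg (pow_nonneg hr0 i)]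
      exact mul_le_one₀ (hh1 _) (pow_nonneg hr0 i) (pow_le_one₀ hr0 hr1)
    simp only [T, Real.norm_eq_abs]
    rw [abs_div, abs_mul, abs_of_pos hpos, abs_of_nonneg (by positivity : (0 : ℝ) ≤ j.factorial),
      div_le_iff₀ hpos, one_div, inv_pow, inv_mul_eq_div, le_div_iff₀ (by positivity)]
    nlinarith [mul_le_mul_of_nonneg_right h3 (by positivity : (0 : ℝ) ≤ 2 ^ i * j.factorial)]
  have hgeom : Summable fun i : ℕ => (1 / 2 : ℝ) ^ i := summable_geometric_two
  have hTs : ∀ j, Summable (T j) := fun j => Summable.of_norm_bounded hgeom (hT j)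
  refine ⟨fun n => Nat.casesOn n 0 fun j => -∑' i, T j i, ?_, ?_⟩
  · rintro (_ | j)
    · simp
    · simp only [abs_neg]
      have := tsum_of_norm_bounded (hgeom.hasSum) (hT j)
      rwa [tsum_geometric_two] at this
  · rintro (_ | j)
    · have h1 := hzero.summable.tsum_eq_zero_add
      rw [hzero.tsum_eq] at h1
      simp only [pow_zero, Nat.factorial_zero, Nat.cast_one, mul_one, div_one] at h1
      simp only [Nat.cast_zero, zero_mul, sub_zero, mul_neg, ← tsum_mul_left]
      have h2 : ∀ i, (r : ℝ) * T 0 i = h (i + 1) * (r : ℝ) ^ (i + 1) / ((i + 1).factorial : ℝ) := by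
        intro i
        simp only [T, Nat.factorial_zero, Nat.cast_one, mul_one, zero_add, add_comm 1 i, pow_succ]
        ring
      simp only [h2]
      change _ = h 0
      linarith
    · have h1 := ((hTs j).mul_left ((j : ℝ) + 1)).tsum_eq_zero_add
      have h2 : ∀ i, ((j : ℝ) + 1) * T j (i + 1) = (r : ℝ) * T (j + 1) i := by
        intro i
        simp only [T, show j + 1 + (i + 1) = j + 1 + 1 + i by ring, Nat.factorial_succ j, pow_succ]
        push_cast
        ring
      have h3 : ((j : ℝ) + 1) * T j 0 = h (j + 1) := by
        have : (j.factorial : ℝ) ≠ 0 := by positivity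
        have : (j : ℝ) + 1 ≠ 0 := by positivity
        simp only [T, add_zero, pow_zero, mul_one, Nat.factorial_succ j]
        push_cast
        field_simp
      simp only [h2, h3, tsum_mul_left] at h1
      change (r : ℝ) * (-∑' i, T (j + 1) i) - ((j + 1 : ℕ) : ℝ) * (-∑' i, T j i) = h (j + 1)
      push_cast
      linarith

/-- A criterion for multivariate Poisson approximation in total variation: the random vector `Z` on
a finite uniform probability space almost satisfies the Stein identities of the Poisson law. -/
theorem abs_prob_sub_pi_poisson_le {Ω ι : Type*} [Fintype Ω] [Nonempty Ω] [Fintype ι]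
    [DecidableEq ι] (Z : Ω → ι → ℕ) (r : ι → NNReal) (hr : ∀ c, r c ≤ 1) (ε : ℝ)
    (H : ∀ (c : ι) (F : (ι → ℕ) → ℝ), (∀ z, |F z| ≤ 1) →
      |(∑ ω, (Z ω c : ℝ) * F (Z ω)) - r c * ∑ ω, F (Z ω + Pi.single c 1)|
        ≤ ε * Fintype.card Ω) (B : Set (ι → ℕ)) [DecidablePred (· ∈ B)] :
    |((Finset.univ.filter fun ω => Z ω ∈ B).card : ℝ) / Fintype.card Ω
      - (Measure.pi fun c => poissonMeasure (r c)).real B| ≤ 2 * Fintype.card ι * ε := by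
  classical
  set μ : ι → Measure ℕ := fun c => poissonMeasure (r c) with hμ
  set f : (ι → ℕ) → ENNReal := B.indicator 1 with hf
  have hfm : Measurable f := Measurable.of_discrete
  let G : Finset ι → (ι → ℕ) → ENNReal := fun S => lmarginal μ S f
  have hG1 : ∀ S z, G S z ≤ 1 := by
    intro S z
    have h1 : f ≤ fun _ => 1 := fun z => by
      simp only [hf]; exact Set.indicator_le_self' (by simp) z
    calc G S z ≤ lmarginal μ S (fun _ => 1) z := lmarginal_mono h1 z
      _ = 1 := by simp [lmarginal]
  have hGt : ∀ S z, G S z ≠ ⊤ := fun S z => ((hG1 S z).trans_lt ENNReal.one_lt_top).ne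
  have hG01 : ∀ S z, 0 ≤ (G S z).toReal ∧ (G S z).toReal ≤ 1 := fun S z =>
    ⟨ENNReal.toReal_nonneg, by simpa using ENNReal.toReal_mono ENNReal.one_ne_top (hG1 S z)⟩
  have hcard : (0 : ℝ) < Fintype.card Ω := by exact_mod_cast Fintype.card_pos
  have step : ∀ (S : Finset ι) (c : ι), c ∉ S →
      |(∑ ω, (G S (Z ω)).toReal) - ∑ ω, (G (insert c S) (Z ω)).toReal|
        ≤ 2 * ε * Fintype.card Ω := by
    intro S c hc
    have hins : ∀ z, (G (insert c S) z).toReal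
        = ∫ q, (G S (Function.update z c q)).toReal ∂poissonMeasure (r c) := by
      intro z
      rw [integral_toReal (Measurable.of_discrete.aemeasurable)
        (Filter.Eventually.of_forall fun q => lt_top_iff_ne_top.2 (hGt _ _))]
      simp only [G]
      rw [lmarginal_insert f hfm hc]
    have hsol := fun u : {u : ℕ → ℝ // ∀ n, 0 ≤ u n ∧ u n ≤ 1} =>
      exists_chenStein_solution (r c) (hr c) u.1 u.2
    choose g hg1 hg2 using hsol
    let u : (ι → ℕ) → {u : ℕ → ℝ // ∀ n, 0 ≤ u n ∧ u n ≤ 1} := fun z =>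
      ⟨fun q => (G S (Function.update z c q)).toReal, fun q => hG01 _ _⟩
    have hu : ∀ z, u (z + Pi.single c 1) = u z := by
      intro z
      apply Subtype.ext
      funext q
      simp only [u]
      congr 2
      funext d
      by_cases hd : d = c
      · subst hd; simp
      · simp [hd]
    have key := H c (fun z => g (u z) (z c) / 2) (fun z => by
      rw [abs_div, abs_two]; linarith [hg1 (u z) (z c)])
    have e : ∀ ω, (G S (Z ω)).toReal - (G (insert c S) (Z ω)).toReal
        = (r c : ℝ) * g (u (Z ω)) (Z ω c + 1) - (Z ω c : ℝ) * g (u (Z ω)) (Z ω c) := by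
      intro ω
      rw [hg2, hins]
      simp [u]
    rw [← Finset.sum_sub_distrib, Finset.sum_congr rfl fun ω _ => e ω, Finset.sum_sub_distrib,
      ← Finset.mul_sum, abs_sub_comm]
    simp only [hu, Pi.add_apply, Pi.single_eq_same] at key
    have e2 : (∑ ω, (Z ω c : ℝ) * (g (u (Z ω)) (Z ω c) / 2)) -
        (r c : ℝ) * ∑ ω, g (u (Z ω)) (Z ω c + 1) / 2 =
        (1 / 2) * ((∑ ω, (Z ω c : ℝ) * g (u (Z ω)) (Z ω c)) -
        (r c : ℝ) * ∑ ω, g (u (Z ω)) (Z ω c + 1)) := by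
      rw [← Finset.sum_div, mul_sub, Finset.mul_sum]
      congr 1
      · exact Finset.sum_congr rfl fun ω _ => by ring
      · ring
    rw [e2, abs_mul, abs_of_pos (by norm_num : (0 : ℝ) < 1 / 2)] at key
    linarith
  have all : ∀ S : Finset ι, |(∑ ω, (G ∅ (Z ω)).toReal) - ∑ ω, (G S (Z ω)).toReal|
      ≤ S.card * (2 * ε * Fintype.card Ω) := by
    intro S
    induction S using Finset.induction_on with
    | empty => simp
    | insert c S hc ih =>
      rw [Finset.card_insert_of_notMem hc]
      have := step S c hc
      refine (abs_sub_le _ _ _).trans ((add_le_add ih this).trans ?_)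
      push_cast
      linarith
  have h0 : ∑ ω, (G ∅ (Z ω)).toReal = ((Finset.univ.filter fun ω => Z ω ∈ B).card : ℝ) := by
    simp only [G, lmarginal_empty, hf]
    rw [Finset.card_filter]
    push_cast
    refine Finset.sum_congr rfl fun ω _ => ?_
    by_cases hω : Z ω ∈ B <;> simp [hω]
  have h1 : ∑ ω, (G Finset.univ (Z ω)).toReal = Fintype.card Ω * (Measure.pi μ).real B := by
    have : ∀ z, G Finset.univ z = Measure.pi μ B := by
      intro z
      simp only [G, lmarginal_univ, hf]
      rw [lintegral_indicator_one]
      exact MeasurableSet.of_discrete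
    simp only [this]
    simp [Measure.real]
  have h2 := all Finset.univ
  rw [h0, h1, Finset.card_univ] at h2
  rw [show ((Finset.univ.filter fun ω => Z ω ∈ B).card : ℝ) / Fintype.card Ω
      - (Measure.pi μ).real B = (((Finset.univ.filter fun ω => Z ω ∈ B).card : ℝ) -
        Fintype.card Ω * (Measure.pi μ).real B) / Fintype.card Ω by
      field_simp, abs_div, abs_of_pos hcard, div_le_iff₀ hcard]
  linarith

/-! ### Counting gluings that contain given pairs -/

section Counting

open scoped Classical

variable {N : ℕ}

theorem Gluing.apply_apply (ω : Gluing N) (s : Side N) : ω.1 (ω.1 s) = s := (ω.2 s).1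

theorem Gluing.apply_ne (ω : Gluing N) (s : Side N) : ω.1 s ≠ s := (ω.2 s).2

/-- The gluing obtained by relabelling the sides. -/
def Gluing.conj (τ : Equiv.Perm (Side N)) (ω : Gluing N) : Gluing N :=
  ⟨τ * ω.1 * τ⁻¹, fun s => by
    refine ⟨by simp [Gluing.apply_apply], fun h => ω.apply_ne (τ⁻¹ s) ?_⟩
    rw [Equiv.Perm.mul_apply, Equiv.Perm.mul_apply] at h
    rw [Equiv.Perm.eq_inv_iff_eq, h]⟩

theorem Gluing.conj_apply (τ : Equiv.Perm (Side N)) (ω : Gluing N) (s : Side N) :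
    (ω.conj τ).1 s = τ (ω.1 (τ⁻¹ s)) := rfl

/-- The gluing obtained by pairing `x` with `y` and the former partners of `x` and `y` with each
other. -/
def Gluing.force (x y : Side N) (ω : Gluing N) : Gluing N := ω.conj (Equiv.swap (ω.1 x) y)

theorem Gluing.conj_swap_conj_swap (t y : Side N) (ω : Gluing N) :
    (ω.conj (Equiv.swap t y)).conj (Equiv.swap t y) = ω := by
  apply Subtype.ext
  ext1 s
  simp [Gluing.conj_apply]

theorem Gluing.force_apply_partner {x y : Side N} (hxy : x ≠ y) (ω : Gluing N) : (ω.force x y).1 (ω.1 x) = ω.1 y := by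
  have h2 : ω.1 y ≠ ω.1 x := fun h => hxy (ω.1.injective h).symm
  rw [Gluing.force, Gluing.conj_apply, Equiv.swap_inv, Equiv.swap_apply_left,
    Equiv.swap_apply_of_ne_of_ne h2 (ω.apply_ne y)]

theorem Gluing.force_apply_of_ne {x y z : Side N} (ω : Gluing N)
    (h1 : z ≠ x) (h2 : z ≠ y) (h3 : z ≠ ω.1 x) (h4 : z ≠ ω.1 y) :
    (ω.force x y).1 z = ω.1 z := by
  rw [Gluing.force, Gluing.conj_apply, Equiv.swap_inv,
    Equiv.swap_apply_of_ne_of_ne h3 h2, Equiv.swap_apply_of_ne_of_ne]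
  · exact fun h => h1 (ω.1.injective h)
  · rintro rfl
    exact h4 (ω.apply_apply z).symm

/-- The sides that occur in a list of pairs. -/
def ends (L : List (Side N × Side N)) : List (Side N) := L.flatMap fun p => [p.1, p.2]

@[simp] theorem ends_nil : ends ([] : List (Side N × Side N)) = [] := rfl

@[simp] theorem ends_cons (p : Side N × Side N) (L : List (Side N × Side N)) :
    ends (p :: L) = p.1 :: p.2 :: ends L := rfl

theorem length_ends (L : List (Side N × Side N)) : (ends L).length = 2 * L.length := by
  induction L with
  | nil => rfl
  | cons p L ih => simp [ih]; ring

theorem mem_ends {L : List (Side N × Side N)} {s : Side N} :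
    s ∈ ends L ↔ ∃ p ∈ L, s = p.1 ∨ s = p.2 := by
  simp [ends, List.mem_flatMap]

/-- The gluings that contain the given pairs. -/
def agreeing (L : List (Side N × Side N)) : Finset (Gluing N) :=
  Finset.univ.filter fun ω => ∀ p ∈ L, ω.1 p.1 = p.2

theorem mem_agreeing {L : List (Side N × Side N)} {ω : Gluing N} :
    ω ∈ agreeing L ↔ ∀ p ∈ L, ω.1 p.1 = p.2 := by
  simp [agreeing]

theorem agreeing_nil : agreeing ([] : List (Side N × Side N)) = Finset.univ := by
  simp [agreeing]

theorem agreeing_cons (s t : Side N) (L : List (Side N × Side N)) :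
    agreeing ((s, t) :: L) = (agreeing L).filter fun ω => ω.1 s = t := by
  ext ω
  simp [mem_agreeing, and_comm]

theorem apply_notMem_ends {L : List (Side N × Side N)} {ω : Gluing N} (hω : ω ∈ agreeing L)
    {s : Side N} (hs : s ∉ ends L) : ω.1 s ∉ ends L := by
  rw [mem_agreeing] at hω
  rintro h
  obtain ⟨p, hp, h | h⟩ := mem_ends.1 h
  · exact hs (mem_ends.2 ⟨p, hp, Or.inr (by rw [← hω p hp, ← h, ω.apply_apply])⟩)
  · rw [← hω p hp] at h
    exact hs (mem_ends.2 ⟨p, hp, Or.inl (ω.1.injective h)⟩)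

theorem conj_swap_mem_agreeing {L : List (Side N × Side N)} {s t y : Side N}
    (hst : s ≠ t) (hsy : s ≠ y) (ht : t ∉ ends L) (hy : y ∉ ends L)
    {ω : Gluing N} (hω : ω ∈ agreeing ((s, t) :: L)) :
    ω.conj (Equiv.swap t y) ∈ agreeing ((s, y) :: L) := by
  rw [mem_agreeing] at hω ⊢
  have key : ∀ e ∈ ends L, Equiv.swap t y e = e := fun e he =>
    Equiv.swap_apply_of_ne_of_ne (fun h => ht (h ▸ he)) (fun h => hy (h ▸ he))
  intro p hp
  rw [List.mem_cons] at hp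
  obtain rfl | hp := hp
  · have := hω (s, t) (by simp)
    simp only at this
    simp only [Gluing.conj_apply, Equiv.swap_inv]
    rw [Equiv.swap_apply_of_ne_of_ne hst hsy, this, Equiv.swap_apply_left]
  · have := hω p (List.mem_cons_of_mem _ hp)
    rw [Gluing.conj_apply, Equiv.swap_inv, key _ (mem_ends.2 ⟨p, hp, Or.inl rfl⟩), this,
      key _ (mem_ends.2 ⟨p, hp, Or.inr rfl⟩)]

theorem card_side : Fintype.card (Side N) = 6 * N := by
  simp; ring

/-- Forcing a pair into a uniform gluing yields a uniform gluing among those with this pair. -/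
theorem sum_force {L : List (Side N × Side N)} {s y : Side N}
    (h : (ends ((s, y) :: L)).Nodup) (f : Gluing N → ℝ) :
    ∑ ω ∈ agreeing L, f (ω.force s y)
      = (6 * N - 1 - 2 * L.length) * ∑ ω ∈ agreeing ((s, y) :: L), f ω := by
  simp only [ends_cons, List.nodup_cons, List.mem_cons, not_or] at h
  obtain ⟨⟨hsy, hs⟩, hy, hL⟩ := h
  have hnd : (s :: ends L).Nodup := List.nodup_cons.2 ⟨hs, hL⟩
  set T : Finset (Side N) := Finset.univ \ (s :: ends L).toFinset with hT
  have hTc : (T.card : ℝ) = 6 * N - 1 - 2 * L.length := by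
    have h1 : (s :: ends L).toFinset.card = 2 * L.length + 1 := by
      rw [List.toFinset_card_of_nodup hnd, List.length_cons, length_ends]
    have h2 := Finset.card_sdiff_add_card_eq_card (Finset.subset_univ (s :: ends L).toFinset)
    rw [h1, Finset.card_univ, card_side] at h2
    have h3 : (T.card : ℝ) + (2 * L.length + 1) = 6 * N := by exact_mod_cast h2
    linarith
  have hmaps : ∀ ω ∈ agreeing L, ω.1 s ∈ T := by
    intro ω hω
    simp only [hT, Finset.mem_sdiff, Finset.mem_univ, true_and, List.mem_toFinset, List.mem_cons,
      not_or]
    exact ⟨ω.apply_ne s, apply_notMem_ends hω hs⟩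
  rw [← Finset.sum_fiberwise_of_maps_to hmaps, ← hTc, ← nsmul_eq_mul]
  refine Finset.sum_eq_card_nsmul fun t ht => ?_
  simp only [hT, Finset.mem_sdiff, Finset.mem_univ, true_and, List.mem_toFinset, List.mem_cons,
      not_or] at ht
  rw [← agreeing_cons]
  refine Finset.sum_nbij' (fun ω => ω.conj (Equiv.swap t y)) (fun ω => ω.conj (Equiv.swap t y))
    (fun ω hω => conj_swap_mem_agreeing (Ne.symm ht.1) hsy ht.2 hy hω) (fun ω hω => ?_)
    (fun ω _ => ω.conj_swap_conj_swap t y) (fun ω _ => ω.conj_swap_conj_swap t y)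
    (fun ω hω => ?_)
  · rw [Equiv.swap_comm]
    exact conj_swap_mem_agreeing hsy (Ne.symm ht.1) hy ht.2 hω
  · rw [agreeing_cons, Finset.mem_filter] at hω
    rw [Gluing.force, hω.2]

theorem card_agreeing_cons {L : List (Side N × Side N)} {s y : Side N}
    (h : (ends ((s, y) :: L)).Nodup) :
    ((agreeing L).card : ℝ) = (6 * N - 1 - 2 * L.length) * (agreeing ((s, y) :: L)).card := by
  simpa using sum_force h fun _ => 1

theorem card_agreeing {L : List (Side N × Side N)} (h : (ends L).Nodup) :
    (Fintype.card (Gluing N) : ℝ)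
      = (∏ i ∈ Finset.range L.length, (6 * N - 1 - 2 * (i : ℝ))) * (agreeing L).card := by
  induction L with
  | nil => simp [agreeing_nil]
  | cons p L ih =>
    have h' : (ends L).Nodup := (List.nodup_cons.1 (List.nodup_cons.1 h).2).2
    rw [ih h', card_agreeing_cons h, List.length_cons, Finset.prod_range_succ]
    ring

theorem agreeing_cons_eq_empty {L : List (Side N × Side N)} {s y : Side N} (hL : (ends L).Nodup)
    (hs : s ∉ ends L) (h : ¬ (ends ((s, y) :: L)).Nodup) : agreeing ((s, y) :: L) = ∅ := by
  rw [agreeing_cons, Finset.filter_eq_empty_iff]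
  rintro ω hω rfl
  refine h ?_
  simp only [ends_cons, List.nodup_cons, List.mem_cons, not_or]
  exact ⟨⟨(ω.apply_ne s).symm, hs⟩, apply_notMem_ends hω hs, hL⟩

/-- A walk that starts with the side `s` and turns left or right in every triangle reaches a
triangle in `A`, or a triangle that it visited before, within `n` turns. -/
def Returns (ω : Gluing N) : ℕ → Finset (Fin (2 * N)) → Side N → Prop
  | 0, A, s => (ω.1 s).1 ∈ A
  | n + 1, A, s => (ω.1 s).1 ∈ A ∨
      ∃ a : Letter, Returns ω n (insert (ω.1 s).1 A) (turnFrom a (ω.1 s))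

theorem turnFrom_fst (a : Letter) (s : Side N) : (turnFrom a s).1 = s.1 := by
  cases a <;> rfl

theorem turnFrom_ne (a : Letter) (s : Side N) : turnFrom a s ≠ s := by
  obtain ⟨i, j⟩ := s
  cases a <;> fin_cases j <;> simp [turnFrom]

theorem exists_turnFrom {s t : Side N} (h : s.1 = t.1) (hne : t ≠ s) : ∃ a, turnFrom a s = t := by
  obtain ⟨i, j⟩ := s
  obtain ⟨i', k⟩ := t
  obtain rfl : i = i' := h
  have hjk : k ≠ j := fun h => hne (by rw [h])
  clear hne
  by_cases h1 : k = j + 1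
  · exact ⟨.R, by rw [h1]; rfl⟩
  · refine ⟨.L, ?_⟩
    have : k = j + 2 := by
      revert j k; decide
    rw [this]; rfl

theorem Returns.mono {ω : Gluing N} {n n' : ℕ} {A A' : Finset (Fin (2 * N))} {s : Side N}
    (h : Returns ω n A s) (hn : n ≤ n') (hA : A ⊆ A') : Returns ω n' A' s := by
  induction n generalizing n' A A' s with
  | zero =>
    cases n' with
    | zero => exact hA h
    | succ n' => exact Or.inl (hA h)
  | succ n ih =>
    obtain ⟨k, rfl⟩ : ∃ k, n' = k + 1 := ⟨n' - 1, by omega⟩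
    obtain h | ⟨a, h⟩ := h
    · exact Or.inl (hA h)
    · exact Or.inr ⟨a, ih h (by omega) (Finset.insert_subset_insert _ hA)⟩

theorem card_filter_fst_mem (A : Finset (Fin (2 * N))) :
    (Finset.univ.filter fun t : Side N => t.1 ∈ A).card = 3 * A.card := by
  have : (Finset.univ.filter fun t : Side N => t.1 ∈ A) = A ×ˢ Finset.univ := by
    ext t; simp
  rw [this, Finset.card_product]
  simp [mul_comm]

theorem card_filter_apply_mem_le {D : ℝ} {L : List (Side N × Side N)} {s : Side N}
    (A : Finset (Fin (2 * N))) (hL : (ends L).Nodup) (hs : s ∉ ends L)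
    (hD : D + 2 * L.length + 1 ≤ 6 * N) :
    D * ((agreeing L).filter fun ω => (ω.1 s).1 ∈ A).card ≤ 3 * A.card * (agreeing L).card := by
  have h1 : ((agreeing L).filter fun ω => (ω.1 s).1 ∈ A) ⊆
      (Finset.univ.filter fun t : Side N => t.1 ∈ A).biUnion fun t => agreeing ((s, t) :: L) := by
    intro ω hω
    simp only [Finset.mem_filter] at hω
    simp only [Finset.mem_biUnion, agreeing_cons, Finset.mem_filter, Finset.mem_univ, true_and]
    exact ⟨ω.1 s, hω.2, hω.1, rfl⟩
  by_cases hD0 : D ≤ 0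
  · exact (mul_nonpos_of_nonpos_of_nonneg hD0 (by positivity)).trans (by positivity)
  push Not at hD0
  have h2 : (((agreeing L).filter fun ω => (ω.1 s).1 ∈ A).card : ℝ) ≤
      ∑ t ∈ Finset.univ.filter fun t : Side N => t.1 ∈ A, ((agreeing ((s, t) :: L)).card : ℝ) := by
    exact_mod_cast (Finset.card_le_card h1).trans Finset.card_biUnion_le
  have h3 : ∀ t : Side N, D * (agreeing ((s, t) :: L)).card ≤ (agreeing L).card := by
    intro t
    by_cases h : (ends ((s, t) :: L)).Nodup
    · rw [card_agreeing_cons h]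
      exact mul_le_mul_of_nonneg_right (by linarith) (by positivity)
    · rw [agreeing_cons_eq_empty hL hs h]; simp
  calc D * (((agreeing L).filter fun ω => (ω.1 s).1 ∈ A).card : ℝ)
      ≤ D * ∑ t ∈ Finset.univ.filter fun t : Side N => t.1 ∈ A,
          ((agreeing ((s, t) :: L)).card : ℝ) := mul_le_mul_of_nonneg_left h2 hD0.le
    _ ≤ ∑ t ∈ Finset.univ.filter fun t : Side N => t.1 ∈ A, ((agreeing L).card : ℝ) := by
        rw [Finset.mul_sum]
        exact Finset.sum_le_sum fun t _ => h3 t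
    _ = _ := by
        rw [Finset.sum_const, card_filter_fst_mem]; simp

/-- In a random gluing that contains given pairs, it is unlikely that some walk from a given side
returns within `n` turns. -/
theorem card_filter_returns_le {D : ℝ} (n : ℕ) {L : List (Side N × Side N)} {s : Side N}
    {A : Finset (Fin (2 * N))} (hL : (ends L).Nodup) (hs : s ∉ ends L) (hsA : s.1 ∈ A)
    (hLA : ∀ e ∈ ends L, e.1 ∈ A) (hD : D + 2 * (L.length + n) + 1 ≤ 6 * N) :
    D * ((agreeing L).filter fun ω => Returns ω n A s).card
      ≤ 2 ^ n * (n + 1) * (3 * (A.card + n)) * (agreeing L).card := by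
  induction n generalizing L s A with
  | zero =>
    have := card_filter_apply_mem_le A hL hs (D := D) (by simpa using hD)
    have e : ((agreeing L).filter fun ω => Returns ω 0 A s)
        = (agreeing L).filter fun ω => (ω.1 s).1 ∈ A := by
      exact Finset.filter_congr fun ω _ => Iff.rfl
    rw [e]
    simpa using this
  | succ n ih =>
    by_cases hD0 : D ≤ 0
    · exact (mul_nonpos_of_nonpos_of_nonneg hD0 (by positivity)).trans (by positivity)
    push Not at hD0
    push_cast at hD
    set P : Letter → Side N → Finset (Gluing N) := fun a t =>
      (agreeing ((s, t) :: L)).filter fun ω => Returns ω n (insert t.1 A) (turnFrom a t) with hP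
    set U : Finset (Side N) := Finset.univ.filter fun t => t.1 ∉ A with hU
    have h1 : ((agreeing L).filter fun ω => Returns ω (n + 1) A s) ⊆
        ((agreeing L).filter fun ω => (ω.1 s).1 ∈ A) ∪
          U.biUnion fun t => P .L t ∪ P .R t := by
      intro ω hω
      simp only [Finset.mem_filter] at hω
      by_cases hA : (ω.1 s).1 ∈ A
      · exact Finset.mem_union_left _ (Finset.mem_filter.2 ⟨hω.1, hA⟩)
      · obtain h | ⟨a, h⟩ := hω.2
        · exact absurd h hA
        · refine Finset.mem_union_right _ (Finset.mem_biUnion.2 ⟨ω.1 s, by simp [hU, hA], ?_⟩)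
          have : ω ∈ agreeing ((s, ω.1 s) :: L) := by
            rw [agreeing_cons]; exact Finset.mem_filter.2 ⟨hω.1, rfl⟩
          cases a
          · exact Finset.mem_union_left _ (Finset.mem_filter.2 ⟨this, h⟩)
          · exact Finset.mem_union_right _ (Finset.mem_filter.2 ⟨this, h⟩)
    have h2 : (((agreeing L).filter fun ω => Returns ω (n + 1) A s).card : ℝ) ≤
        ((agreeing L).filter fun ω => (ω.1 s).1 ∈ A).card +
          ∑ t ∈ U, (((P .L t).card : ℝ) + (P .R t).card) := by
      have := (Finset.card_le_card h1).trans ((Finset.card_union_le _ _).trans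
        (Nat.add_le_add_left (Finset.card_biUnion_le.trans
          (Finset.sum_le_sum fun t _ => Finset.card_union_le _ _)) _))
      exact_mod_cast this
    have h3 : ∀ t ∈ U, ∀ a, D * (P a t).card
        ≤ 2 ^ n * (n + 1) * (3 * (A.card + 1 + n)) * (agreeing ((s, t) :: L)).card := by
      intro t ht a
      have htA : t.1 ∉ A := by simpa [hU] using ht
      have htL : t ∉ ends L := fun h => htA (hLA t h)
      have hst : s ≠ t := by rintro rfl; exact htA hsA
      have hnd : (ends ((s, t) :: L)).Nodup := by
        simp only [ends_cons, List.nodup_cons, List.mem_cons, not_or]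
        exact ⟨⟨hst, hs⟩, htL, hL⟩
      have := ih (L := (s, t) :: L) (s := turnFrom a t) (A := insert t.1 A) hnd ?_ ?_ ?_ ?_
      · rw [Finset.card_insert_of_notMem htA] at this
        push_cast at this
        exact this
      · simp only [ends_cons, List.mem_cons, not_or]
        refine ⟨fun h => htA ?_, turnFrom_ne a t, fun h => htA ?_⟩
        · rw [← turnFrom_fst a t, h]; exact hsA
        · rw [← turnFrom_fst a t]; exact hLA _ h
      · rw [turnFrom_fst]; exact Finset.mem_insert_self _ _
      · intro e he
        simp only [ends_cons, List.mem_cons] at he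
        obtain rfl | rfl | he := he
        · exact Finset.mem_insert_of_mem hsA
        · exact Finset.mem_insert_self _ _
        · exact Finset.mem_insert_of_mem (hLA e he)
      · rw [List.length_cons]; push_cast; linarith
    have h4 : ∑ t ∈ U, ((agreeing ((s, t) :: L)).card : ℝ) ≤ (agreeing L).card := by
      have := Finset.card_eq_sum_card_fiberwise (f := fun ω : Gluing N => ω.1 s)
        (s := agreeing L) (t := Finset.univ) (fun _ _ => Finset.mem_coe.2 (Finset.mem_univ _))
      rw [this]
      simp only [agreeing_cons]
      exact_mod_cast Finset.sum_le_sum_of_subset (Finset.subset_univ U)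
    have h5 := card_filter_apply_mem_le A hL hs (D := D) (by linarith)
    have h6 : D * ∑ t ∈ U, (((P .L t).card : ℝ) + (P .R t).card)
        ≤ 2 * (2 ^ n * (n + 1) * (3 * (A.card + 1 + n))) * (agreeing L).card := by
      calc D * ∑ t ∈ U, (((P .L t).card : ℝ) + (P .R t).card)
          ≤ ∑ t ∈ U, 2 * (2 ^ n * (n + 1) * (3 * (A.card + 1 + n))) *
              ((agreeing ((s, t) :: L)).card : ℝ) := by
            rw [Finset.mul_sum]
            refine Finset.sum_le_sum fun t ht => ?_
            linarith [h3 t ht .L, h3 t ht .R]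
        _ ≤ _ := by
            rw [← Finset.mul_sum]
            exact mul_le_mul_of_nonneg_left h4 (by positivity)
    have h7 : D * (((agreeing L).filter fun ω => Returns ω (n + 1) A s).card : ℝ) ≤
        (3 * A.card + 2 * (2 ^ n * (n + 1) * (3 * (A.card + 1 + n)))) * (agreeing L).card := by
      have := mul_le_mul_of_nonneg_left h2 hD0.le
      linarith
    refine h7.trans (mul_le_mul_of_nonneg_right ?_ (by positivity))
    have hp : (1 : ℝ) ≤ 2 ^ n := one_le_pow₀ (by norm_num)
    have ha : (0 : ℝ) ≤ A.card := by positivity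
    have hn : (0 : ℝ) ≤ n := by positivity
    push_cast
    rw [pow_succ]
    nlinarith [mul_nonneg (sub_nonneg.2 hp) (add_nonneg (add_nonneg ha hn) zero_le_one)]

end Counting

/-! ### Cyclic sequences -/

section Cyclic

variable {α β : Type*}

/-- The periodic sequence obtained by repeating a list. -/
def cyc (l : List α) (hl : l ≠ []) (i : ℕ) : α :=
  l[i % l.length]'(Nat.mod_lt _ (List.length_pos_of_ne_nil hl))

theorem cyc_mem (l : List α) (hl : l ≠ []) (i : ℕ) : cyc l hl i ∈ l := List.getElem_mem _

theorem cyc_of_lt {l : List α} (hl : l ≠ []) {i : ℕ} (hi : i < l.length) :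
    cyc l hl i = l[i] := by
  simp [cyc, Nat.mod_eq_of_lt hi]

theorem exists_cyc_eq {l : List α} (hl : l ≠ []) {x : α} (hx : x ∈ l) : ∃ i, cyc l hl i = x := by
  obtain ⟨i, hi, rfl⟩ := List.mem_iff_getElem.1 hx
  exact ⟨i, cyc_of_lt hl hi⟩

theorem cyc_congr {l : List α} (hl : l ≠ []) {i j : ℕ} (h : i % l.length = j % l.length) :
    cyc l hl i = cyc l hl j := by
  simp [cyc, h]

theorem cyc_add_length (l : List α) (hl : l ≠ []) (i : ℕ) :
    cyc l hl (i + l.length) = cyc l hl i := cyc_congr hl (by simp)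

theorem cyc_eq_cyc_iff {l : List α} (hl : l ≠ []) (hnd : l.Nodup) {i j : ℕ} :
    cyc l hl i = cyc l hl j ↔ i % l.length = j % l.length := by
  simp [cyc, hnd.getElem_inj_iff]

theorem rotate_ne_nil {l : List α} (hl : l ≠ []) (n : ℕ) : l.rotate n ≠ [] := by
  simpa using hl

theorem cyc_rotate {l : List α} (hl : l ≠ []) (n i : ℕ) :
    cyc (l.rotate n) (rotate_ne_nil hl n) i = cyc l hl (i + n) := by
  simp [cyc, List.getElem_rotate]

theorem map_reverse_ne_nil {l : List α} (hl : l ≠ []) (f : α → β) : (l.map f).reverse ≠ [] := by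
  simpa using hl

theorem cyc_map_reverse {l : List α} (hl : l ≠ []) (f : α → β) {i j : ℕ}
    (h : (i + j + 1) % l.length = 0) :
    cyc (l.map f).reverse (map_reverse_ne_nil hl f) i = f (cyc l hl j) := by
  have hpos := List.length_pos_of_ne_nil hl
  simp only [cyc, List.getElem_reverse, List.getElem_map, List.length_reverse, List.length_map]
  congr 2
  have h1 := Nat.mod_lt i hpos
  have h2 := Nat.mod_lt j hpos
  have h3 : (i % l.length + j % l.length + 1) % l.length = 0 := by
    rw [← h]; simp [Nat.add_mod]
  obtain ⟨c, hc⟩ := Nat.dvd_of_mod_eq_zero h3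
  have hc1 : c = 1 := by
    rcases c with _ | _ | c
    · simp at hc
    · rfl
    · nlinarith
  subst hc1
  omega

theorem ext_cyc {l l' : List α} (hl : l ≠ []) (hl' : l' ≠ []) (hlen : l.length = l'.length)
    (h : ∀ i, cyc l hl i = cyc l' hl' i) : l = l' := by
  refine List.ext_getElem hlen fun i h1 h2 => ?_
  rw [← cyc_of_lt hl h1, ← cyc_of_lt hl' h2, h]

theorem cyc_ofFn {d : ℕ} (f : ℕ → α) (hl : (List.ofFn fun t : Fin d => f t) ≠ []) (i : ℕ) :
    cyc (List.ofFn fun t : Fin d => f t) hl i = f (i % d) := by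
  simp [cyc]

/-- A list that follows a shorter nonrepeating cyclic list is a power of a rotation of it. -/
theorem eq_flatten_replicate_of_cyc {a b : List α} (ha : a ≠ []) (hb : b ≠ []) (hnd : a.Nodup)
    {i j : ℕ} (h : ∀ t, cyc b hb (i + t) = cyc a ha (j + t)) :
    ∃ s q, b = (List.replicate q (a.rotate s)).flatten := by
  have hbpos := List.length_pos_of_ne_nil hb
  have hdvd : a.length ∣ b.length := by
    have h1 : cyc a ha (j + b.length) = cyc a ha j := by
      have h0 := h 0
      rw [← h, cyc_add_length]; simpa using h0
    rw [cyc_eq_cyc_iff ha hnd] at h1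
    have h2 : (j + b.length) ≡ j + 0 [MOD a.length] := h1
    exact (Nat.modEq_zero_iff_dvd.1 (Nat.ModEq.add_left_cancel' j h2))
  obtain ⟨q, hq⟩ := hdvd
  refine ⟨j + i * (b.length - 1), q, ?_⟩
  have key : ∀ t, cyc b hb t = cyc a ha (t + (j + i * (b.length - 1))) := by
    intro t
    have h1 := h (t + i * (b.length - 1))
    have h2 : cyc b hb t = cyc b hb (i + (t + i * (b.length - 1))) := by
      apply cyc_congr
      obtain ⟨e, he⟩ : ∃ e, b.length = e + 1 := ⟨b.length - 1, by omega⟩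
      rw [show i + (t + i * (b.length - 1)) = t + i * b.length by rw [he]; simp; ring]
      simp
    rw [h2, h1]
    congr 1; ring
  have hb' : b = List.ofFn fun t : Fin b.length => cyc b hb t := by
    refine List.ext_getElem (by simp) fun t h1 h2 => ?_
    simp [cyc_of_lt hb h1]
  have ha' : a.rotate (j + i * (b.length - 1)) = List.ofFn fun t : Fin a.length =>
      cyc a ha (t + (j + i * (b.length - 1))) := by
    refine List.ext_getElem (by simp) fun t h1 h2 => ?_
    rw [← cyc_of_lt (rotate_ne_nil ha _) h1, cyc_rotate ha]
    simp
  have h3 : ∀ n, n = q * a.length → (List.ofFn fun t : Fin n => cyc b hb t)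
      = (List.replicate q (a.rotate (j + i * (b.length - 1)))).flatten := by
    rintro n rfl
    rw [List.ofFn_mul, ← List.ofFn_const, ha']
    congr 2
    funext u
    congr 1
    funext v
    rw [key]
    apply cyc_congr
    simp [add_assoc]
  have h4 := h3 b.length (by rw [hq]; ring)
  rw [← h4]
  exact hb'

end Cyclic

/-! ### Traced curves -/

section Traced

variable {N : ℕ}

/-- The triangles whose sides a list of sides contains. -/
def triangles (l : List (Side N)) : Finset (Fin (2 * N)) := (l.map Prod.fst).toFinset

theorem mem_triangles {l : List (Side N)} {i : Fin (2 * N)} :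
    i ∈ triangles l ↔ ∃ x ∈ l, x.1 = i := by
  simp [triangles]

theorem card_triangles_le (l : List (Side N)) : (triangles l).card ≤ l.length := by
  simpa [triangles] using List.toFinset_card_le (l.map Prod.fst)

/-- A list of sides of distinct triangles. -/
def Simple (l : List (Side N)) : Prop := (l.map Prod.fst).Nodup

theorem Simple.nodup {l : List (Side N)} (h : Simple l) : l.Nodup := List.Nodup.of_map _ h

theorem Simple.eq {l : List (Side N)} (h : Simple l) {x y : Side N} (hx : x ∈ l) (hy : y ∈ l)
    (hxy : x.1 = y.1) : x = y := List.inj_on_of_nodup_map h hx hy hxy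

theorem Simple.of_isRotated {l l' : List (Side N)} (h : Simple l) (hr : l' ~r l) : Simple l' :=
  (hr.map Prod.fst).nodup_iff.2 h

theorem triangles_eq_of_isRotated {l l' : List (Side N)} (hr : l' ~r l) :
    triangles l' = triangles l := by
  ext i
  simp [mem_triangles, hr.mem_iff]

/-- Nonempty closed curves that never turn back. -/
def IsTraced (ω : Gluing N) (l : List (Side N)) : Prop :=
  ∃ hl : l ≠ [], ∀ i, (cyc l hl (i + 1)).1 = (ω.1 (cyc l hl i)).1 ∧
    cyc l hl (i + 1) ≠ ω.1 (cyc l hl i)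

theorem traces_iff {ω : Gluing N} {l : List (Side N)} {w : List Letter} (hl : l ≠ [])
    (hw : w ≠ []) : Traces ω l w ↔ l.length = w.length ∧
      ∀ i, cyc l hl (i + 1) = turnFrom (cyc w hw i) (ω.1 (cyc l hl i)) := by
  unfold Traces
  refine and_congr_right fun hlen => ⟨fun h i => ?_, fun h => ?_⟩
  · rw [← cyc_rotate hl]
    simp only [cyc, h, List.getElem_zipWith, List.length_zipWith, hlen, min_self]
  · refine List.ext_getElem (by simp [hlen]) fun i h1 h2 => ?_
    have hi : i < l.length := by simpa using h1
    rw [← cyc_of_lt (rotate_ne_nil hl 1) h1, cyc_rotate hl, h, List.getElem_zipWith,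
      cyc_of_lt hl hi, cyc_of_lt hw (hlen ▸ hi)]

theorem Traces.ne_nil {ω : Gluing N} {l : List (Side N)} {w : List Letter} (h : Traces ω l w)
    (hw : w ≠ []) : l ≠ [] := by
  rintro rfl
  exact hw (List.length_eq_zero_iff.1 h.1.symm)

theorem Traces.isTraced {ω : Gluing N} {l : List (Side N)} {w : List Letter} (h : Traces ω l w)
    (hw : w ≠ []) : IsTraced ω l := by
  refine ⟨h.ne_nil hw, fun i => ?_⟩
  rw [((traces_iff (h.ne_nil hw) hw).1 h).2]
  exact ⟨turnFrom_fst _ _, turnFrom_ne _ _⟩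

theorem IsTraced.exists_traces {ω : Gluing N} {l : List (Side N)} (h : IsTraced ω l) :
    ∃ w : List Letter, w ≠ [] ∧ Traces ω l w := by
  obtain ⟨hl, h⟩ := h
  choose f hf using fun i => exists_turnFrom (h i).1.symm (h i).2
  have hw : (List.ofFn fun t : Fin l.length => f t) ≠ [] := by
    simpa [List.ofFn_eq_nil_iff] using hl
  refine ⟨_, hw, (traces_iff hl hw).2 ⟨by simp, fun i => ?_⟩⟩
  rw [cyc_ofFn, cyc_congr hl (i := i) (j := i % l.length) (by simp), hf]
  exact cyc_congr hl (by simp)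

theorem turnFrom_injective (s : Side N) : Function.Injective fun a => turnFrom a s := by
  obtain ⟨i, j⟩ := s
  intro a b h
  cases a <;> cases b <;> fin_cases j <;> simp [turnFrom] at h ⊢

theorem Traces.unique {ω : Gluing N} {l : List (Side N)} {w w' : List Letter} (h : Traces ω l w)
    (h' : Traces ω l w') : w = w' := by
  by_cases hw : w = []
  · subst hw
    exact (List.length_eq_zero_iff.1 (h'.1.symm.trans h.1)).symm
  · have hl := h.ne_nil hw
    have hw' : w' ≠ [] := by
      rintro rfl
      exact hl (List.length_eq_zero_iff.1 h'.1)
    refine ext_cyc hw hw' (h.1.symm.trans h'.1) fun i => ?_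
    have h1 := ((traces_iff hl hw).1 h).2 i
    rw [((traces_iff hl hw').1 h').2 i] at h1
    exact (turnFrom_injective _ h1).symm

theorem IsTraced.isClosedCurve {ω : Gluing N} {l : List (Side N)} (h : IsTraced ω l) :
    IsClosedCurve ω l := by
  obtain ⟨hl, h⟩ := h
  intro p hp
  obtain ⟨i, hi, rfl⟩ := List.mem_iff_getElem.1 hp
  have hi' : i < l.length := by simpa using hi
  rw [List.getElem_zip]
  simp only [Side.triangle]
  rw [← cyc_of_lt hl hi', ← cyc_of_lt (rotate_ne_nil hl 1) (by simpa using hi'), cyc_rotate hl]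
  exact (h i).1.symm

theorem Traces.rotate {ω : Gluing N} {l : List (Side N)} {w : List Letter} (h : Traces ω l w)
    (hw : w ≠ []) (n : ℕ) : Traces ω (l.rotate n) (w.rotate n) := by
  have hl := h.ne_nil hw
  rw [traces_iff (rotate_ne_nil hl n) (rotate_ne_nil hw n)]
  refine ⟨by simpa using h.1, fun i => ?_⟩
  rw [cyc_rotate hl, cyc_rotate hl, cyc_rotate hw, ← ((traces_iff hl hw).1 h).2]
  congr 1; ring

/-- The curve run backwards. -/
def revCurve (ω : Gluing N) (l : List (Side N)) : List (Side N) := (l.map ω.1).reverse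

@[simp] theorem length_revCurve (ω : Gluing N) (l : List (Side N)) :
    (revCurve ω l).length = l.length := by simp [revCurve]

theorem mem_revCurve {ω : Gluing N} {l : List (Side N)} {x : Side N} :
    x ∈ revCurve ω l ↔ ω.1 x ∈ l := by
  simp only [revCurve, List.mem_reverse, List.mem_map]
  refine ⟨?_, fun h => ⟨_, h, ω.apply_apply x⟩⟩
  rintro ⟨y, hy, rfl⟩
  rwa [ω.apply_apply]

theorem exists_add_mod_eq_zero {k : ℕ} (hk : 0 < k) (i : ℕ) : ∃ j, (i + j + 1) % k = 0 := by
  obtain ⟨e, rfl⟩ : ∃ e, k = e + 1 := ⟨k - 1, by omega⟩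
  refine ⟨(i + 1) * e, ?_⟩
  rw [show i + (i + 1) * e + 1 = (i + 1) * (e + 1) by ring]
  simp

theorem turnFrom_swap {a : Letter} {s t : Side N} (h : t = turnFrom a s) :
    s = turnFrom a.swap t := by
  subst h
  obtain ⟨i, j⟩ := s
  cases a <;> fin_cases j <;> simp [turnFrom, Letter.swap]

theorem Traces.revCurve {ω : Gluing N} {l : List (Side N)} {w : List Letter} (h : Traces ω l w)
    (hw : w ≠ []) : Traces ω (revCurve ω l) ((flipWord w).rotate 1) := by
  have hl := h.ne_nil hw
  have hw' : flipWord w ≠ [] := map_reverse_ne_nil hw _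
  obtain ⟨hlen, h⟩ := (traces_iff hl hw).1 h
  have hr : _root_.revCurve ω l ≠ [] := map_reverse_ne_nil hl _
  rw [traces_iff hr (rotate_ne_nil hw' 1)]
  refine ⟨by simpa [_root_.revCurve, flipWord] using hlen, fun i => ?_⟩
  obtain ⟨j, hj⟩ := exists_add_mod_eq_zero (List.length_pos_of_ne_nil hl) (i + 1)
  rw [cyc_rotate hw', show cyc (flipWord w) hw' (i + 1) = (cyc w hw j).swap from
    cyc_map_reverse hw _ (hlen ▸ hj)]
  rw [show cyc (_root_.revCurve ω l) _ (i + 1) = ω.1 (cyc l hl j) from cyc_map_reverse hl _ hj,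
    show cyc (_root_.revCurve ω l) _ i = ω.1 (cyc l hl (j + 1)) from
      cyc_map_reverse hl _ (by rw [← hj]; congr 1; ring), ω.apply_apply]
  exact turnFrom_swap (h j)

theorem IsTraced.rotate {ω : Gluing N} {l : List (Side N)} (h : IsTraced ω l) (n : ℕ) :
    IsTraced ω (l.rotate n) := by
  obtain ⟨w, hw, h⟩ := h.exists_traces
  exact (h.rotate hw n).isTraced (rotate_ne_nil hw n)

theorem IsTraced.revCurve {ω : Gluing N} {l : List (Side N)} (h : IsTraced ω l) :
    IsTraced ω (revCurve ω l) := by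
  obtain ⟨w, hw, h⟩ := h.exists_traces
  exact (h.revCurve hw).isTraced (rotate_ne_nil (map_reverse_ne_nil hw _) 1)

theorem IsTraced.map_fst_revCurve {ω : Gluing N} {l : List (Side N)} (h : IsTraced ω l) :
    (_root_.revCurve ω l).map Prod.fst = ((l.map Prod.fst).rotate 1).reverse := by
  obtain ⟨hl, h⟩ := h
  rw [_root_.revCurve, List.map_reverse]
  congr 1
  rw [List.map_map, ← List.map_rotate]
  refine List.ext_getElem (by simp) fun i h1 h2 => ?_
  have hi : i < l.length := by simpa using h1
  rw [List.getElem_map, List.getElem_map, ← cyc_of_lt hl hi,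
    ← cyc_of_lt (rotate_ne_nil hl 1) (by simpa using hi), cyc_rotate hl]
  exact (h i).1.symm

theorem Simple.revCurve {ω : Gluing N} {l : List (Side N)} (h : Simple l) (ht : IsTraced ω l) :
    Simple (revCurve ω l) := by
  rw [Simple, ht.map_fst_revCurve, List.nodup_reverse, List.nodup_rotate]
  exact h

theorem IsTraced.triangles_revCurve {ω : Gluing N} {l : List (Side N)} (h : IsTraced ω l) :
    triangles (_root_.revCurve ω l) = triangles l := by
  rw [triangles, h.map_fst_revCurve]
  ext i
  simp [triangles]

theorem IsTraced.apply_fst_mem_triangles {ω : Gluing N} {l : List (Side N)} (h : IsTraced ω l)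
    {x : Side N} (hx : x ∈ l) : (ω.1 x).1 ∈ triangles l := by
  obtain ⟨hl, h⟩ := h
  obtain ⟨i, rfl⟩ := exists_cyc_eq hl hx
  rw [← (h i).1]
  exact mem_triangles.2 ⟨_, cyc_mem l hl _, rfl⟩

/-! ### Walks and returns -/

theorem returns_of_walk {ω : Gluing N} {n : ℕ} {A : Finset (Fin (2 * N))} (b : ℕ → Side N)
    (h : ∀ i < n, (ω.1 (b i)).1 ∉ A → (b (i + 1)).1 = (ω.1 (b i)).1 ∧ b (i + 1) ≠ ω.1 (b i))
    (hn : (ω.1 (b n)).1 ∈ A) : Returns ω n A (b 0) := by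
  induction n generalizing b A with
  | zero => exact hn
  | succ n ih =>
    by_cases hA : (ω.1 (b 0)).1 ∈ A
    · exact Or.inl hA
    · obtain ⟨h1, h2⟩ := h 0 (by omega) hA
      obtain ⟨a, ha⟩ := exists_turnFrom h1.symm h2
      refine Or.inr ⟨a, ?_⟩
      rw [ha]
      exact ih (fun i => b (i + 1)) (fun i hi hiA => h (i + 1) (by omega)
        fun hm => hiA (Finset.mem_insert_of_mem hm)) (Finset.mem_insert_of_mem hn)

/-- A closed curve returns to the triangle from which it starts. -/
theorem IsTraced.returns {ω : Gluing N} {l : List (Side N)} (h : IsTraced ω l) {x : Side N}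
    (hx : x ∈ l) {A : Finset (Fin (2 * N))} (hA : x.1 ∈ A) {n : ℕ} (hn : l.length ≤ n) :
    Returns ω n A x := by
  obtain ⟨hl, h⟩ := h
  have hpos := List.length_pos_of_ne_nil hl
  obtain ⟨i, rfl⟩ := exists_cyc_eq hl hx
  have := returns_of_walk (ω := ω) (n := l.length - 1) (A := A) (fun j => cyc l hl (i + j))
    (fun j _ _ => h (i + j)) (by
      rw [← (h _).1, show i + (l.length - 1) + 1 = i + l.length by omega, cyc_add_length]
      exact hA)
  exact this.mono (by omega) subset_rfl

theorem Gluing.force_apply_partner_right {x y : Side N} (hxy : x ≠ y) (ω : Gluing N) :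
    (ω.force x y).1 (ω.1 y) = ω.1 x := by
  have h2 : ω.1 y ≠ ω.1 x := fun h => hxy (ω.1.injective h).symm
  rw [Gluing.force, Gluing.conj_apply, Equiv.swap_inv,
    Equiv.swap_apply_of_ne_of_ne h2 (ω.apply_ne y), ω.apply_apply, Equiv.swap_apply_right]

/-- Forcing a pair of sides of triangles in `A` does not destroy curves that avoid `A`. -/
theorem IsTraced.force {ω : Gluing N} {l : List (Side N)} (h : IsTraced ω l) {x y : Side N}
    {A : Finset (Fin (2 * N))} (hx : x.1 ∈ A) (hy : y.1 ∈ A) (hA : ∀ z ∈ l, z.1 ∉ A) :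
    IsTraced (ω.force x y) l := by
  obtain ⟨hl, h⟩ := h
  refine ⟨hl, fun i => ?_⟩
  have hz := hA _ (cyc_mem l hl i)
  have hz' := hA _ (cyc_mem l hl (i + 1))
  rw [(h i).1] at hz'
  rw [Gluing.force_apply_of_ne]
  · exact h i
  · rintro e; exact hz (e ▸ hx)
  · rintro e; exact hz (e ▸ hy)
  · rintro e; rw [e, ω.apply_apply] at hz'; exact hz' hx
  · rintro e; rw [e, ω.apply_apply] at hz'; exact hz' hy

/-- Curves that avoid `A` and are created by forcing a pair of sides of triangles in `A` come from
walks that return to `A`. -/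
theorem IsTraced.of_force {ω : Gluing N} {l : List (Side N)} {x y : Side N} (hxy : x ≠ y)
    (h : IsTraced (ω.force x y) l) {A : Finset (Fin (2 * N))} (hx : x.1 ∈ A) (hy : y.1 ∈ A)
    (hA : ∀ z ∈ l, z.1 ∉ A) {n : ℕ} (hn : l.length ≤ n)
    (hrx : ¬ Returns ω n A x) (hry : ¬ Returns ω n A y) : IsTraced ω l := by
  obtain ⟨hl, h⟩ := h
  have hpos := List.length_pos_of_ne_nil hl
  have hne : ∀ i, cyc l hl i ≠ x ∧ cyc l hl i ≠ y := fun i =>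
    ⟨fun e => hA _ (cyc_mem l hl i) (e ▸ hx), fun e => hA _ (cyc_mem l hl i) (e ▸ hy)⟩
  have hstep : ∀ i, (ω.1 (cyc l hl i)).1 ∉ A →
      (cyc l hl (i + 1)).1 = (ω.1 (cyc l hl i)).1 ∧ cyc l hl (i + 1) ≠ ω.1 (cyc l hl i) := by
    intro i hi
    have := h i
    rwa [Gluing.force_apply_of_ne ω (hne i).1 (hne i).2
      (fun e => hi (by rw [e, ω.apply_apply]; exact hx))
      (fun e => hi (by rw [e, ω.apply_apply]; exact hy))] at this
  have hwalk : ∀ (u v : Side N) (i : ℕ), v.1 ∈ A → cyc l hl i = ω.1 v →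
      (ω.force x y).1 (cyc l hl i) = ω.1 u → Returns ω n A u := by
    intro u v i hv hi hu
    have := returns_of_walk (ω := ω) (n := l.length) (A := A)
      (fun j => Nat.casesOn j u fun j => cyc l hl (i + 1 + j)) (fun j _ hj => ?_) ?_
    · exact this.mono hn subset_rfl
    · cases j with
      | zero =>
        have := h i
        rw [hu] at this
        exact this
      | succ j => exact hstep (i + 1 + j) hj
    · obtain ⟨k, hk⟩ : ∃ k, l.length = k + 1 := ⟨l.length - 1, by omega⟩
      rw [hk]
      change (ω.1 (cyc l hl (i + 1 + k))).1 ∈ A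
      rw [show i + 1 + k = i + l.length by omega, cyc_add_length, hi, ω.apply_apply]
      exact hv
  refine ⟨hl, fun i => ?_⟩
  by_cases h1 : cyc l hl i = ω.1 x
  · exact absurd (hwalk y x i hx h1 (by rw [h1, Gluing.force_apply_partner hxy])) hry
  · by_cases h2 : cyc l hl i = ω.1 y
    · exact absurd (hwalk x y i hy h2 (by rw [h2, Gluing.force_apply_partner_right hxy])) hrx
    · have := h i
      rwa [Gluing.force_apply_of_ne ω (hne i).1 (hne i).2 h1 h2] at this

/-- Some walk that starts with a side not crossed by the curve `a`, in a triangle of `a`, returns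
within `n` turns. -/
def Escapes (ω : Gluing N) (n : ℕ) (a : List (Side N)) : Prop :=
  ∃ z : Side N, z.1 ∈ triangles a ∧ z ∉ a ∧ ω.1 z ∉ a ∧ Returns ω n (triangles a) z

theorem Escapes.of_revCurve {ω : Gluing N} {n : ℕ} {a : List (Side N)} (ha : IsTraced ω a)
    (h : Escapes ω n (revCurve ω a)) : Escapes ω n a := by
  obtain ⟨z, h1, h2, h3, h4⟩ := h
  rw [ha.triangles_revCurve] at h1 h4
  rw [mem_revCurve] at h2 h3
  rw [ω.apply_apply] at h3
  exact ⟨z, h1, h3, h2, h4⟩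

theorem mem_or_mem_of_not_escapes {ω : Gluing N} {n : ℕ} {a b : List (Side N)}
    (hb : IsTraced ω b) (hn : b.length ≤ n) (hesc : ¬ Escapes ω n a) {z : Side N} (hz : z ∈ b)
    (hza : z.1 ∈ triangles a) : z ∈ a ∨ ω.1 z ∈ a := by
  by_contra hcon
  push Not at hcon
  exact hesc ⟨z, hza, hcon.1, hcon.2, hb.returns hz hza hn⟩

theorem eq_power_of_mem_of_not_escapes {ω : Gluing N} {n : ℕ} {a b : List (Side N)}
    (ha : IsTraced ω a) (has : Simple a) (hb : IsTraced ω b) (hn : b.length ≤ n)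
    (hesc : ¬ Escapes ω n a) {z : Side N} (hzb : z ∈ b) (hza : z ∈ a) :
    ∃ s q, b = (List.replicate q (a.rotate s)).flatten := by
  have hmem := fun (z : Side N) (hz : z ∈ b) (hza : z.1 ∈ triangles a) =>
    mem_or_mem_of_not_escapes hb hn hesc hz hza
  obtain ⟨hla, ha⟩ := ha
  obtain ⟨hlb, hb⟩ := hb
  obtain ⟨i, rfl⟩ := exists_cyc_eq hlb hzb
  obtain ⟨j, hj⟩ := exists_cyc_eq hla hza
  refine eq_flatten_replicate_of_cyc hla hlb has.nodup (i := i) (j := j) fun t => ?_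
  induction t with
  | zero => exact hj.symm
  | succ t ih =>
    have h1 : (cyc b hlb (i + t + 1)).1 = (cyc a hla (j + t + 1)).1 := by
      rw [(hb _).1, (ha _).1, ih]
    obtain h2 | h2 := hmem _ (cyc_mem b hlb (i + t + 1))
      (mem_triangles.2 ⟨_, cyc_mem a hla (j + t + 1), h1.symm⟩)
    · exact has.eq h2 (cyc_mem a hla _) h1
    · obtain ⟨u, hu⟩ := exists_cyc_eq hla h2
      have h3 : cyc a hla (u + 1) = cyc a hla (j + t + 1) := by
        refine has.eq (cyc_mem _ _ _) (cyc_mem _ _ _) ?_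
        rw [← h1, (ha u).1, hu, ω.apply_apply]
      have h4 : cyc a hla u = cyc a hla (j + t) := by
        rw [cyc_eq_cyc_iff hla has.nodup] at h3 ⊢
        exact Nat.ModEq.add_right_cancel' 1 h3
      exfalso
      apply (hb (i + t)).2
      rw [ih, ← h4, hu, ω.apply_apply]

/-- A closed curve that touches a simple curve `a` from which no walk escapes is a power of `a` or
of its reverse, up to the choice of the starting point. -/
theorem eq_power_of_not_escapes {ω : Gluing N} {n : ℕ} {a b : List (Side N)}
    (ha : IsTraced ω a) (has : Simple a) (hb : IsTraced ω b) (hn : b.length ≤ n)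
    (hesc : ¬ Escapes ω n a) {z : Side N} (hzb : z ∈ b) (hza : z.1 ∈ triangles a) :
    ∃ c q, (c ~r a ∨ c ~r revCurve ω a) ∧ b = (List.replicate q c).flatten := by
  obtain h | h := mem_or_mem_of_not_escapes hb hn hesc hzb hza
  · obtain ⟨s, q, h⟩ := eq_power_of_mem_of_not_escapes ha has hb hn hesc hzb h
    exact ⟨_, q, Or.inl (List.IsRotated.forall a s), h⟩
  · obtain ⟨s, q, h⟩ := eq_power_of_mem_of_not_escapes ha.revCurve (has.revCurve ha) hb hn
      (fun h => hesc (Escapes.of_revCurve ha h)) hzb (mem_revCurve.2 h)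
    exact ⟨_, q, Or.inr (List.IsRotated.forall _ s), h⟩

theorem eq_one_of_nodup_replicate {α : Type*} {q : ℕ} {c : List α}
    (h : ((List.replicate q c).flatten).Nodup) (hne : (List.replicate q c).flatten ≠ []) :
    q = 1 := by
  rcases q with _ | _ | q
  · simp at hne
  · rfl
  · exfalso
    cases c with
    | nil => simp at hne
    | cons x c => simp [List.replicate_succ] at h

/-- A simple curve that touches a simple curve `a` from which no walk escapes is `a` or its
reverse, up to the choice of the starting point. -/
theorem isRotated_of_not_escapes {ω : Gluing N} {n : ℕ} {a b : List (Side N)}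
    (ha : IsTraced ω a) (has : Simple a) (hb : IsTraced ω b) (hbs : Simple b) (hn : b.length ≤ n)
    (hesc : ¬ Escapes ω n a) {z : Side N} (hzb : z ∈ b) (hza : z.1 ∈ triangles a) :
    b ~r a ∨ b ~r revCurve ω a := by
  obtain ⟨c, q, h, e⟩ := eq_power_of_not_escapes ha has hb hn hesc hzb hza
  have hq := eq_one_of_nodup_replicate (e ▸ hbs.nodup) (e ▸ hb.1)
  subst hq
  obtain rfl : b = c := by simpa using e
  exact h

/-- Every closed curve passes through a simple one. -/
theorem IsTraced.exists_simple {ω : Gluing N} {b : List (Side N)} (hb : IsTraced ω b) :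
    ∃ a, IsTraced ω a ∧ Simple a ∧ a.length ≤ b.length ∧ ∃ z ∈ b, z ∈ a := by
  classical
  obtain ⟨hl, hb⟩ := hb
  have hpos := List.length_pos_of_ne_nil hl
  set f := cyc b hl with hf
  have hex : ∃ d, 0 < d ∧ ∃ i, (f i).1 = (f (i + d)).1 :=
    ⟨b.length, hpos, 0, by rw [hf, cyc_add_length]⟩
  obtain ⟨hd, i, hi⟩ := Nat.find_spec hex
  have hmin : ∀ d' < Nat.find hex, 0 < d' → ∀ j, (f j).1 ≠ (f (j + d')).1 :=
    fun d' hd' h0 j h => Nat.find_min hex hd' ⟨h0, j, h⟩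
  have hdb : Nat.find hex ≤ b.length :=
    Nat.find_min' hex ⟨hpos, 0, by rw [hf, cyc_add_length]⟩
  set d := Nat.find hex
  have hne : (List.ofFn fun t : Fin d => f (i + t)) ≠ [] := by
    rw [Ne, List.ofFn_eq_nil_iff]; omega
  have hcyc : ∀ t, cyc (List.ofFn fun t : Fin d => f (i + t)) hne t = f (i + t % d) :=
    fun t => cyc_ofFn (fun t => f (i + t)) hne t
  refine ⟨_, ⟨hne, fun t => ?_⟩, ?_, by simpa using hdb, f i, cyc_mem _ _ _, ?_⟩
  · rw [hcyc, hcyc]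
    have ht : t % d < d := Nat.mod_lt _ hd
    by_cases h1 : t % d + 1 < d
    · rw [show (t + 1) % d = t % d + 1 by
        rw [Nat.add_mod, Nat.mod_eq_of_lt (by omega : 1 < d), Nat.mod_eq_of_lt h1]]
      exact hb (i + t % d)
    · have h2 : t % d + 1 = d := by omega
      have h3 : (t + 1) % d = 0 := by
        rw [← Nat.mod_add_mod, h2, Nat.mod_self]
      rw [h3, add_zero]
      have h4 := hb (i + t % d)
      rw [add_assoc, h2] at h4
      refine ⟨hi.trans h4.1, fun e => ?_⟩
      have e' : f (i + t % d) = ω.1 (f i) := by rw [e, ω.apply_apply]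
      rcases hr : t % d with _ | _ | r
      · rw [hr] at e'
        exact ω.apply_ne _ e'.symm
      · rw [hr] at e'
        exact (hb i).2 e'
      · refine hmin (r + 1) (by omega) (by omega) (i + 1) ?_
        rw [(hb i).1, ← e', hr]
        congr 2; ring
  · rw [Simple, List.map_ofFn, List.nodup_ofFn]
    intro u v huv
    by_contra hne
    wlog huv' : u < v generalizing u v
    · exact this huv.symm (Ne.symm hne) (lt_of_le_of_ne (not_lt.1 huv') (Ne.symm hne))
    · refine hmin (v - u) (by omega) (by omega) (i + u) ?_
      rw [show i + (u : ℕ) + (v - u) = i + v by omega]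
      exact huv
  · rw [List.mem_ofFn]
    exact ⟨⟨0, hd⟩, by simp⟩

/-- Some simple curve of length at most `m` has an escaping walk. -/
def Tangled (ω : Gluing N) (m : ℕ) : Prop :=
  ∃ a, IsTraced ω a ∧ Simple a ∧ a.length ≤ m ∧ Escapes ω m a

theorem IsTraced.eq_power_of_not_tangled {ω : Gluing N} {m : ℕ} (hω : ¬ Tangled ω m)
    {b : List (Side N)} (hb : IsTraced ω b) (hm : b.length ≤ m) :
    ∃ c q, IsTraced ω c ∧ Simple c ∧ b = (List.replicate q c).flatten := by
  obtain ⟨a, ha, has, hab, z, hzb, hza⟩ := hb.exists_simple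
  obtain ⟨c, q, h, e⟩ := eq_power_of_not_escapes ha has hb hm
    (fun h => hω ⟨a, ha, has, hab.trans hm, h⟩) hzb (mem_triangles.2 ⟨z, hza, rfl⟩)
  obtain h | h := h
  · obtain ⟨s, hs⟩ := h.symm
    exact ⟨c, q, hs ▸ ha.rotate s, has.of_isRotated h, e⟩
  · obtain ⟨s, hs⟩ := h.symm
    exact ⟨c, q, hs ▸ ha.revCurve.rotate s, (has.revCurve ha).of_isRotated h, e⟩

end Traced

/-! ### Homotopy classes of simple curves -/

section Homotopy

open scoped Classical

variable {N : ℕ}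

/-- The number of signed crossings of a side. -/
noncomputable def flux (ω : Gluing N) (l : List (Side N)) (x : Side N) : ℤ :=
  (l.count x : ℤ) - l.count (ω.1 x)

theorem flux_eq_or_neg_of_equiv {ω : Gluing N} {γ δ : ClosedCurve ω}
    (h : (⟦γ⟧ : HomotopyClass ω) = ⟦δ⟧) :
    (∀ x, flux ω γ.1 x = flux ω δ.1 x) ∨ ∀ x, flux ω γ.1 x = -flux ω δ.1 x := by
  have h' : Relation.EqvGen (CurveMove ω) γ δ := Quotient.exact h
  clear h
  induction h' with
  | rel γ δ h =>
    cases h with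
    | rotate n h =>
      left; intro x
      simp only [flux, h, (List.rotate_perm _ n).count_eq]
    | backtrack p q y hγ hδ =>
      left; intro x
      simp only [flux, hγ, hδ, List.count_append, List.count_cons, beq_iff_eq]
      have h1 : (ω.1 y = x) ↔ y = ω.1 x :=
        ⟨fun h => by rw [← h, ω.apply_apply], fun h => by rw [h, ω.apply_apply]⟩
      have h2 : (ω.1 y = ω.1 x) ↔ y = x := ω.1.injective.eq_iff
      simp only [h1, h2]
      push_cast
      ring
    | reverse h =>
      right; intro x
      have h1 : ∀ x, (δ.1).count x = γ.1.count (ω.1 x) := by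
        intro x
        rw [h, List.count_reverse]
        conv_lhs => rw [← ω.apply_apply x]
        exact List.count_map_of_injective _ _ ω.1.injective _
      simp only [flux, h1, ω.apply_apply]
      ring
  | refl γ => exact Or.inl fun _ => rfl
  | symm γ δ _ ih =>
    obtain h | h := ih
    · exact Or.inl fun x => (h x).symm
    · exact Or.inr fun x => by rw [h x, neg_neg]
  | trans γ δ ε _ _ ih1 ih2 =>
    obtain h | h := ih1 <;> obtain k | k := ih2
    · exact Or.inl fun x => (h x).trans (k x)
    · exact Or.inr fun x => (h x).trans (k x)
    · exact Or.inr fun x => by rw [h x, k x]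
    · exact Or.inl fun x => by rw [h x, k x, neg_neg]

theorem Simple.apply_notMem {ω : Gluing N} {l : List (Side N)} (hs : Simple l)
    (h : IsTraced ω l) {x : Side N} (hx : x ∈ l) : ω.1 x ∉ l := by
  obtain ⟨hl, h⟩ := h
  obtain ⟨i, rfl⟩ := exists_cyc_eq hl hx
  exact fun hm => (h i).2 (hs.eq (cyc_mem _ _ _) hm (h i).1)

theorem flux_of_mem {ω : Gluing N} {l : List (Side N)} (hs : Simple l)
    (h : IsTraced ω l) {x : Side N} (hx : x ∈ l) : flux ω l x = 1 := by
  rw [flux, List.count_eq_one_of_mem hs.nodup hx,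
    List.count_eq_zero_of_not_mem (hs.apply_notMem h hx)]
  simp

theorem mem_of_flux_pos {ω : Gluing N} {l : List (Side N)} {x : Side N} (h : 0 < flux ω l x) :
    x ∈ l := by
  by_contra hx
  rw [flux, List.count_eq_zero_of_not_mem hx] at h
  simp only [Nat.cast_zero, zero_sub] at h
  omega

theorem flux_flatten_replicate (ω : Gluing N) (l : List (Side N)) (k : ℕ) (x : Side N) :
    flux ω (List.replicate k l).flatten x = k * flux ω l x := by
  simp [flux, List.count_flatten, List.map_replicate, mul_sub]

theorem isPrimitive_of_simple {ω : Gluing N} {γ : ClosedCurve ω} (hs : Simple γ.1)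
    (h : IsTraced ω γ.1) : HomotopyClass.IsPrimitive (⟦γ⟧ : HomotopyClass ω) := by
  rintro ⟨γ', δ, k, hk, hδ, e⟩
  obtain ⟨x, hx⟩ := List.exists_mem_of_ne_nil _ h.1
  have h1 := flux_of_mem hs h hx
  have h2 := flux_flatten_replicate ω γ'.1 k x
  rw [← hδ] at h2
  have h3 : (k : ℤ) ∣ 1 := by
    obtain e | e := flux_eq_or_neg_of_equiv e
    · rw [← h1, ← e x, h2]; exact dvd_mul_right _ _
    · rw [← h1, ← neg_neg (flux ω γ.1 x), ← e x, h2]; exact (dvd_mul_right _ _).neg_right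
  have := Int.le_of_dvd one_pos h3
  omega

theorem isRotated_of_subset {ω : Gluing N} {a b : List (Side N)} (ha : IsTraced ω a)
    (has : Simple a) (hb : IsTraced ω b) (hbs : Simple b) (h : ∀ z ∈ b, z ∈ a) : b ~r a := by
  obtain ⟨hla, ha⟩ := ha
  obtain ⟨hlb, hb⟩ := hb
  obtain ⟨j, hj⟩ := exists_cyc_eq hla (h _ (cyc_mem b hlb 0))
  have key : ∀ t, cyc b hlb (0 + t) = cyc a hla (j + t) := by
    intro t
    induction t with
    | zero => exact hj.symm
    | succ t ih =>
      refine has.eq (h _ (cyc_mem _ _ _)) (cyc_mem _ _ _) ?_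
      rw [← add_assoc, ← add_assoc, (hb _).1, (ha _).1, ih]
  obtain ⟨s, q, e⟩ := eq_flatten_replicate_of_cyc hla hlb has.nodup key
  have hq := eq_one_of_nodup_replicate (e ▸ hbs.nodup) (e ▸ hlb)
  subst hq
  rw [e]
  simp

theorem equiv_of_isRotated {ω : Gluing N} {γ δ : ClosedCurve ω} (h : γ.1 ~r δ.1) :
    (⟦γ⟧ : HomotopyClass ω) = ⟦δ⟧ := by
  obtain ⟨n, h⟩ := h
  exact Quotient.sound (Relation.EqvGen.rel _ _ (CurveMove.rotate γ δ n h.symm))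

theorem equiv_iff_of_simple {ω : Gluing N} {γ δ : ClosedCurve ω} (hγ : IsTraced ω γ.1)
    (hγs : Simple γ.1) (hδ : IsTraced ω δ.1) (hδs : Simple δ.1) :
    (⟦δ⟧ : HomotopyClass ω) = ⟦γ⟧ ↔ δ.1 ~r γ.1 ∨ δ.1 ~r revCurve ω γ.1 := by
  refine ⟨fun h => ?_, fun h => ?_⟩
  · obtain h | h := flux_eq_or_neg_of_equiv h
    · refine Or.inl (isRotated_of_subset hγ hγs hδ hδs fun z hz => mem_of_flux_pos (ω := ω) ?_)
      rw [← h, flux_of_mem hδs hδ hz]; exact one_pos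
    · refine Or.inr (isRotated_of_subset hγ.revCurve (hγs.revCurve hγ) hδ hδs fun z hz =>
        mem_revCurve.2 (mem_of_flux_pos (ω := ω) ?_))
      have h1 : flux ω γ.1 (ω.1 z) = -flux ω γ.1 z := by
        simp only [flux, ω.apply_apply]; ring
      rw [h1, ← h, flux_of_mem hδs hδ hz]; exact one_pos
  · obtain h | h := h
    · exact equiv_of_isRotated h
    · have h2 : (⟦γ⟧ : HomotopyClass ω) = ⟦⟨revCurve ω γ.1, hγ.revCurve.isClosedCurve⟩⟧ :=
        Quotient.sound (Relation.EqvGen.rel _ _ (CurveMove.reverse _ _ rfl))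
      rw [h2]
      exact equiv_of_isRotated h

/-! ### Counting simple curves -/

/-- The simple curves that trace a word in the class `c`. -/
def simpleCurves (ω : Gluing N) (c : WordClass) : Set (List (Side N)) :=
  {l | Simple l ∧ ∃ w : Word, (⟦w⟧ : WordClass) = c ∧ Traces ω l w.1}

theorem isTraced_of_mem_simpleCurves {ω : Gluing N} {c : WordClass} {l : List (Side N)}
    (h : l ∈ simpleCurves ω c) : IsTraced ω l := by
  obtain ⟨_, w, _, h⟩ := h
  exact h.isTraced w.2

theorem length_of_mem_simpleCurves {ω : Gluing N} {c : WordClass} {l : List (Side N)}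
    (h : l ∈ simpleCurves ω c) : l.length = c.length := by
  obtain ⟨_, w, rfl, h⟩ := h
  exact h.1

theorem finite_simpleCurves (ω : Gluing N) (c : WordClass) : (simpleCurves ω c).Finite :=
  (List.finite_length_eq (Side N) c.length).subset fun _ h => length_of_mem_simpleCurves h

theorem mem_simpleCurves_of_isRotated {ω : Gluing N} {c : WordClass} {l l' : List (Side N)}
    (h : l ∈ simpleCurves ω c) (hr : l' ~r l) : l' ∈ simpleCurves ω c := by
  refine ⟨h.1.of_isRotated hr, ?_⟩
  obtain ⟨_, w, rfl, h⟩ := h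
  obtain ⟨n, rfl⟩ := hr.symm
  refine ⟨⟨w.1.rotate n, rotate_ne_nil w.2 n⟩, Quotient.sound (Or.inl ?_), h.rotate w.2 n⟩
  exact List.IsRotated.forall _ _

theorem revCurve_mem_simpleCurves {ω : Gluing N} {c : WordClass} {l : List (Side N)}
    (h : l ∈ simpleCurves ω c) : revCurve ω l ∈ simpleCurves ω c := by
  refine ⟨h.1.revCurve (isTraced_of_mem_simpleCurves h), ?_⟩
  obtain ⟨_, w, rfl, h⟩ := h
  refine ⟨⟨(flipWord w.1).rotate 1, rotate_ne_nil (map_reverse_ne_nil w.2 _) 1⟩,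
    Quotient.sound (Or.inr ?_), h.revCurve w.2⟩
  have := flipWord_isRotated (List.IsRotated.forall (flipWord w.1) 1)
  rwa [flipWord_flipWord] at this

/-- The curves that differ from `a` by the starting point and the orientation. -/
noncomputable def reparametrizations (ω : Gluing N) (a : List (Side N)) :
    Finset (List (Side N)) :=
  a.cyclicPermutations.toFinset ∪ (revCurve ω a).cyclicPermutations.toFinset

theorem mem_reparametrizations {ω : Gluing N} {a l : List (Side N)} :
    l ∈ reparametrizations ω a ↔ l ~r a ∨ l ~r revCurve ω a := by
  simp [reparametrizations, List.mem_cyclicPermutations_iff]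

theorem card_reparametrizations {ω : Gluing N} {a : List (Side N)} (ha : IsTraced ω a)
    (has : Simple a) : (reparametrizations ω a).card = 2 * a.length := by
  rw [reparametrizations, Finset.card_union_of_disjoint,
    List.toFinset_card_of_nodup has.nodup.cyclicPermutations,
    List.toFinset_card_of_nodup (has.revCurve ha).nodup.cyclicPermutations,
    List.length_cyclicPermutations_of_ne_nil _ ha.1,
    List.length_cyclicPermutations_of_ne_nil _ ha.revCurve.1, length_revCurve]
  · ring
  · rw [Finset.disjoint_left]
    intro l h1 h2
    rw [List.mem_toFinset, List.mem_cyclicPermutations_iff] at h1 h2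
    obtain ⟨x, hx⟩ := List.exists_mem_of_ne_nil _ ha.1
    exact has.apply_notMem ha hx (mem_revCurve.1 ((h1.symm.trans h2).mem_iff.1 hx))

/-- The number of homotopy classes of simple curves of type `c`. -/
noncomputable def simpleCount (c : WordClass) (ω : Gluing N) : ℕ :=
  (simpleCurves ω c).ncard / (2 * c.length)

theorem length_pos (c : WordClass) : 0 < c.length := by
  induction c using Quotient.inductionOn with
  | h w => exact List.length_pos_of_ne_nil w.2

theorem ncard_simpleCurves (c : WordClass) (ω : Gluing N) :
    (simpleCurves ω c).ncard = 2 * c.length *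
      {h : HomotopyClass ω | ∃ γ : ClosedCurve ω, γ.1 ∈ simpleCurves ω c ∧ ⟦γ⟧ = h}.ncard := by
  have hfin := finite_simpleCurves ω c
  let φ : List (Side N) → HomotopyClass ω := fun l =>
    if h : IsClosedCurve ω l then ⟦⟨l, h⟩⟧ else ⟦⟨[], by simp [IsClosedCurve]⟩⟧
  have hφ : ∀ γ : ClosedCurve ω, φ γ.1 = ⟦γ⟧ := fun γ => dif_pos γ.2
  have hset : {h : HomotopyClass ω | ∃ γ : ClosedCurve ω, γ.1 ∈ simpleCurves ω c ∧ ⟦γ⟧ = h}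
      = (hfin.toFinset.image φ : Finset _) := by
    ext h
    simp only [Set.mem_ofPred_eq, Finset.coe_image, Set.Finite.coe_toFinset, Set.mem_image]
    constructor
    · rintro ⟨γ, h1, rfl⟩
      exact ⟨γ.1, h1, hφ γ⟩
    · rintro ⟨l, h1, rfl⟩
      exact ⟨⟨l, (isTraced_of_mem_simpleCurves h1).isClosedCurve⟩, h1, (hφ _).symm⟩
  rw [hset, Set.ncard_coe_finset, Set.ncard_eq_toFinset_card _ hfin,
    Finset.card_eq_sum_card_image φ, Finset.sum_const_nat (m := 2 * c.length), mul_comm]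
  intro h hh
  obtain ⟨a, ha, rfl⟩ := Finset.mem_image.1 hh
  rw [Set.Finite.mem_toFinset] at ha
  have hat := isTraced_of_mem_simpleCurves ha
  rw [← length_of_mem_simpleCurves ha, ← card_reparametrizations hat ha.1]
  congr 1
  ext l
  rw [Finset.mem_filter, Set.Finite.mem_toFinset, mem_reparametrizations]
  have key : ∀ hl : l ∈ simpleCurves ω c, φ l = φ a ↔ l ~r a ∨ l ~r revCurve ω a := by
    intro hl
    have hlt := isTraced_of_mem_simpleCurves hl
    have := equiv_iff_of_simple (γ := ⟨a, hat.isClosedCurve⟩) (δ := ⟨l, hlt.isClosedCurve⟩)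
      hat ha.1 hlt hl.1
    rwa [← hφ, ← hφ] at this
  constructor
  · rintro ⟨h1, h2⟩
    exact (key h1).1 h2
  · intro h
    have hl : l ∈ simpleCurves ω c := by
      obtain h | h := h
      · exact mem_simpleCurves_of_isRotated ha h
      · exact mem_simpleCurves_of_isRotated (revCurve_mem_simpleCurves ha) h
    exact ⟨hl, (key hl).2 h⟩

theorem simpleCount_eq_ncard (c : WordClass) (ω : Gluing N) : simpleCount c ω =
    {h : HomotopyClass ω | ∃ γ : ClosedCurve ω, γ.1 ∈ simpleCurves ω c ∧ ⟦γ⟧ = h}.ncard := by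
  rw [simpleCount, ncard_simpleCurves,
    Nat.mul_div_cancel_left _ (Nat.mul_pos two_pos (length_pos c))]

theorem two_mul_length_mul_simpleCount (c : WordClass) (ω : Gluing N) :
    2 * c.length * simpleCount c ω = (simpleCurves ω c).ncard := by
  rw [simpleCount_eq_ncard, ← ncard_simpleCurves]

/-- Off the tangled gluings, the primitive classes are those of the simple curves. -/
theorem geodesicCount_eq_simpleCount {ω : Gluing N} {m : ℕ} (hω : ¬ Tangled ω m) {c : WordClass}
    (hc : c.length ≤ m) : geodesicCount c ω = simpleCount c ω := by
  rw [simpleCount_eq_ncard, geodesicCount]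
  congr 1
  ext h
  constructor
  · rintro ⟨hp, γ, w, rfl, rfl, ht⟩
    refine ⟨γ, ⟨?_, w, rfl, ht⟩, rfl⟩
    have hγ := ht.isTraced w.2
    obtain ⟨a, q, ha, has, e⟩ := hγ.eq_power_of_not_tangled hω (ht.1.trans_le hc)
    rcases q with _ | _ | q
    · exact absurd (by simpa using e) hγ.1
    · have : γ.1 = a := by simpa using e
      rw [this]; exact has
    · exact absurd ⟨⟨a, ha.isClosedCurve⟩, γ, q + 2, by omega, e, rfl⟩ hp
  · rintro ⟨γ, h1, rfl⟩
    have ht := isTraced_of_mem_simpleCurves h1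
    obtain ⟨hs, w, hw, h1⟩ := h1
    exact ⟨isPrimitive_of_simple hs ht, γ, w, rfl, hw, h1⟩

end Homotopy

/-! ### The pairs of sides that a simple curve prescribes -/

section Coupling

open scoped Classical

variable {N : ℕ}

/-- The pairs of sides that have to be glued for the list `l` to trace the word `w`. -/
def pairsOf (l : List (Side N)) (w : List Letter) : List (Side N × Side N) :=
  l.zip (List.zipWith (fun a x => turnFrom a.swap x) w (l.rotate 1))

theorem length_pairsOf {l : List (Side N)} {w : List Letter} (h : l.length = w.length) :
    (pairsOf l w).length = l.length := by
  simp [pairsOf, h]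

theorem mem_agreeing_pairsOf {ω : Gluing N} {l : List (Side N)} {w : List Letter}
    (h : l.length = w.length) : ω ∈ agreeing (pairsOf l w) ↔ Traces ω l w := by
  rw [mem_agreeing, List.forall_mem_iff_getElem]
  have hiff : ∀ (a : Letter) (s t : Side N), s = turnFrom a.swap t ↔ t = turnFrom a s := by
    refine fun a s t => ⟨fun e => ?_, turnFrom_swap⟩
    have := turnFrom_swap e
    rwa [Letter.swap_swap] at this
  constructor
  · intro hp
    refine ⟨h, List.ext_getElem (by simp [h]) fun i h1 h2 => ?_⟩
    have := hp i (by rw [length_pairsOf h]; simpa using h1)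
    simp only [pairsOf, List.getElem_zip, List.getElem_zipWith] at this
    rw [List.getElem_zipWith]
    exact (hiff _ _ _).1 this
  · rintro ⟨_, ht⟩ i hi
    have hi' : i < l.length := by rwa [length_pairsOf h] at hi
    simp only [pairsOf, List.getElem_zip, List.getElem_zipWith]
    rw [hiff]
    have := List.getElem_of_eq ht (i := i) (by simpa using hi')
    rw [this, List.getElem_zipWith]

theorem ends_perm (L : List (Side N × Side N)) :
    (ends L).Perm (L.map Prod.fst ++ L.map Prod.snd) := by
  induction L with
  | nil => simp
  | cons p L ih =>
    simp only [ends_cons, List.map_cons, List.cons_append]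
    exact (((ih.cons p.2).trans List.perm_middle.symm)).cons p.1

theorem map_fst_pairsOf {l : List (Side N)} {w : List Letter} (h : l.length = w.length) :
    (pairsOf l w).map Prod.fst = l := by
  rw [pairsOf, List.map_fst_zip]
  simp [h]

theorem map_snd_pairsOf {l : List (Side N)} {w : List Letter} (h : l.length = w.length) :
    (pairsOf l w).map Prod.snd
      = List.zipWith (fun a x => turnFrom a.swap x) w (l.rotate 1) := by
  rw [pairsOf, List.map_snd_zip]
  simp [h]

theorem map_fst_zipWith_turnFrom {l : List (Side N)} {w : List Letter} (h : l.length = w.length) :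
    (List.zipWith (fun a x => turnFrom a.swap x) w l).map Prod.fst = l.map Prod.fst := by
  refine List.ext_getElem (by simp [h]) fun i h1 h2 => ?_
  simp [turnFrom_fst]

theorem nodup_ends_pairsOf {l : List (Side N)} {w : List Letter} (h : l.length = w.length)
    (hs : Simple l) : (ends (pairsOf l w)).Nodup := by
  have hs' : ((l.rotate 1).map Prod.fst).Nodup := by
    rw [List.map_rotate, List.nodup_rotate]; exact hs
  rw [(ends_perm _).nodup_iff, map_fst_pairsOf h, map_snd_pairsOf h, List.nodup_append]
  refine ⟨hs.nodup, List.Nodup.of_map Prod.fst ?_, ?_⟩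
  · rw [map_fst_zipWith_turnFrom (by simp [h])]
    exact hs'
  · rintro x hx y hy rfl
    obtain ⟨i, hi, e⟩ := List.mem_iff_getElem.1 hy
    rw [List.getElem_zipWith] at e
    have h1 : (l.rotate 1)[i]'(by simp at hi ⊢; omega) ∈ l :=
      List.mem_rotate.1 (List.getElem_mem _)
    refine turnFrom_ne _ _ (e.trans (hs.eq hx h1 ?_))
    rw [← e, turnFrom_fst]

theorem fst_mem_triangles_of_mem_ends {l : List (Side N)} {w : List Letter}
    (h : l.length = w.length) {e : Side N} (he : e ∈ ends (pairsOf l w)) :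
    e.1 ∈ triangles l := by
  rw [(ends_perm _).mem_iff, map_fst_pairsOf h, map_snd_pairsOf h, List.mem_append] at he
  obtain he | he := he
  · exact mem_triangles.2 ⟨e, he, rfl⟩
  · have h1 := List.mem_map_of_mem (f := Prod.fst) he
    rw [map_fst_zipWith_turnFrom (by simp [h]), List.map_rotate, List.mem_rotate] at h1
    simpa [triangles] using h1

theorem notMem_ends_pairsOf {ω : Gluing N} {l : List (Side N)} {w : List Letter}
    (h : Traces ω l w) {z : Side N} (h1 : z ∉ l) (h2 : ω.1 z ∉ l) : z ∉ ends (pairsOf l w) := by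
  have hω := mem_agreeing.1 ((mem_agreeing_pairsOf h.1).2 h)
  intro hz
  obtain ⟨p, hp, e⟩ := mem_ends.1 hz
  have hpl : p.1 ∈ l := by
    rw [← map_fst_pairsOf h.1]; exact List.mem_map_of_mem hp
  obtain rfl | rfl := e
  · exact h1 hpl
  · rw [← hω p hp, ω.apply_apply] at h2
    exact h2 hpl

/-! ### Averages over gluings that contain given pairs -/

theorem Gluing.nonempty (N : ℕ) : Nonempty (Gluing N) := by
  refine ⟨⟨⟨fun s => (s.1.rev, s.2), fun s => (s.1.rev, s.2), fun s => by simp, fun s => by simp⟩,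
    fun s => ⟨by simp, fun e => ?_⟩⟩⟩
  have h1 : s.1.rev = s.1 := congrArg Prod.fst e
  have h2 := congrArg Fin.val h1
  rw [Fin.val_rev] at h2
  have := s.1.isLt
  omega

/-- The average over the gluings that contain the given pairs. -/
noncomputable def avg (L : List (Side N × Side N)) (f : Gluing N → ℝ) : ℝ :=
  (∑ ω ∈ agreeing L, f ω) / (agreeing L).card

/-- The conditional probability of a property given that the gluing contains the given pairs. -/
noncomputable def prob (L : List (Side N × Side N)) (P : Gluing N → Prop) : ℝ :=
  ((agreeing L).filter P).card / (agreeing L).card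

theorem card_gluing_pos (N : ℕ) : (0 : ℝ) < Fintype.card (Gluing N) := by
  have := Gluing.nonempty N
  exact_mod_cast Fintype.card_pos

theorem card_agreeing_pos {L : List (Side N × Side N)} (h : (ends L).Nodup) :
    (0 : ℝ) < (agreeing L).card := by
  have h1 := card_agreeing h
  rcases (Nat.cast_nonneg (α := ℝ) (agreeing L).card).lt_or_eq with h2 | h2
  · exact h2
  · rw [← h2, mul_zero] at h1
    exact absurd h1 (card_gluing_pos N).ne'

theorem abs_sum_sub_sum_le {Ω : Type*} (S : Finset Ω) (f g : Ω → ℝ) (P : Ω → Prop)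
    (hf : ∀ ω, |f ω| ≤ 1) (hg : ∀ ω, |g ω| ≤ 1) (h : ∀ ω ∈ S, ¬ P ω → f ω = g ω) :
    |∑ ω ∈ S, f ω - ∑ ω ∈ S, g ω| ≤ 2 * (S.filter P).card := by
  rw [← Finset.sum_sub_distrib]
  refine (Finset.abs_sum_le_sum_abs _ _).trans ?_
  rw [Finset.card_filter]
  push_cast
  rw [Finset.mul_sum]
  refine Finset.sum_le_sum fun ω hω => ?_
  by_cases hP : P ω
  · simp only [hP, if_true, mul_one]
    exact (abs_sub _ _).trans (by linarith [hf ω, hg ω])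
  · simp [h ω hω hP, hP]

theorem abs_avg_sub_avg_le {L : List (Side N × Side N)} (hL : (ends L).Nodup)
    (f g : Gluing N → ℝ) (P : Gluing N → Prop)
    (hf : ∀ ω, |f ω| ≤ 1) (hg : ∀ ω, |g ω| ≤ 1) (h : ∀ ω ∈ agreeing L, ¬ P ω → f ω = g ω) :
    |avg L f - avg L g| ≤ 2 * prob L P := by
  have hpos := card_agreeing_pos hL
  rw [avg, avg, prob, ← sub_div, abs_div, abs_of_pos hpos, ← mul_div_assoc]
  exact div_le_div_of_nonneg_right (abs_sum_sub_sum_le _ f g P hf hg h) hpos.le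

theorem prob_mono {L : List (Side N × Side N)} {P Q : Gluing N → Prop}
    (h : ∀ ω ∈ agreeing L, P ω → Q ω) : prob L P ≤ prob L Q := by
  refine div_le_div_of_nonneg_right ?_ (by positivity)
  exact_mod_cast Finset.card_le_card fun ω hω => by
    rw [Finset.mem_filter] at hω ⊢
    exact ⟨hω.1, h ω hω.1 hω.2⟩

theorem prob_or_le {L : List (Side N × Side N)} (P Q : Gluing N → Prop) :
    prob L (fun ω => P ω ∨ Q ω) ≤ prob L P + prob L Q := by
  rw [prob, prob, prob, ← add_div]
  refine div_le_div_of_nonneg_right ?_ (by positivity)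
  refine le_trans (Nat.cast_le.2 (Finset.card_le_card
    (t := (agreeing L).filter P ∪ (agreeing L).filter Q) fun ω hω => ?_)) ?_
  · simpa only [Finset.mem_union, Finset.mem_filter, and_or_left] using hω
  · exact_mod_cast Finset.card_union_le _ _

theorem prob_exists_le {ι : Type*} {L : List (Side N × Side N)} (S : Finset ι)
    (P : ι → Gluing N → Prop) {δ : ℝ} (h : ∀ i ∈ S, prob L (P i) ≤ δ) :
    prob L (fun ω => ∃ i ∈ S, P i ω) ≤ S.card * δ := by
  have h1 : prob L (fun ω => ∃ i ∈ S, P i ω) ≤ ∑ i ∈ S, prob L (P i) := by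
    simp only [prob]
    rw [← Finset.sum_div]
    refine div_le_div_of_nonneg_right ?_ (by positivity)
    refine le_trans (Nat.cast_le.2 (Finset.card_le_card
      (t := S.biUnion fun i => (agreeing L).filter (P i)) fun ω hω => ?_)) ?_
    · simp only [Finset.mem_filter, Finset.mem_biUnion] at hω ⊢
      obtain ⟨h1, i, hi, h2⟩ := hω
      exact ⟨i, hi, h1, h2⟩
    · exact_mod_cast Finset.card_biUnion_le
  refine h1.trans ((Finset.sum_le_sum h).trans ?_)
  simp

/-- The bound for the probability that a walk returns within `m` turns to one of `m` triangles. -/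
noncomputable def returnBound (N m : ℕ) : ℝ := 2 ^ m * (m + 1) * (2 * m) / N

theorem returnBound_nonneg (N m : ℕ) : 0 ≤ returnBound N m := by
  unfold returnBound; positivity

theorem prob_returns_le {m : ℕ} (hm : 1 ≤ m) (hN : 2 * m ≤ N) {L : List (Side N × Side N)}
    {s : Side N} {A : Finset (Fin (2 * N))} (hL : (ends L).Nodup) (hs : s ∉ ends L)
    (hsA : s.1 ∈ A) (hLA : ∀ e ∈ ends L, e.1 ∈ A) (hLm : L.length ≤ m) (hA : A.card ≤ m) :
    prob L (fun ω => Returns ω m A s) ≤ returnBound N m := by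
  have hpos := card_agreeing_pos hL
  have hm' : (1 : ℝ) ≤ m := by exact_mod_cast hm
  have hN' : 2 * (m : ℝ) ≤ N := by exact_mod_cast hN
  have hLm' : (L.length : ℝ) ≤ m := by exact_mod_cast hLm
  have hA' : (A.card : ℝ) ≤ m := by exact_mod_cast hA
  have h := card_filter_returns_le (D := 3 * N) m hL hs hsA hLA (by linarith)
  have hN0 : (0 : ℝ) < N := by linarith
  rw [prob, returnBound, div_le_div_iff₀ hpos hN0]
  have h2 : 2 ^ m * ((m : ℝ) + 1) * (3 * (A.card + m)) * (agreeing L).card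
      ≤ 2 ^ m * ((m : ℝ) + 1) * (3 * (m + m)) * (agreeing L).card := by gcongr
  linarith

theorem prob_escapes_le {m : ℕ} (hm : 1 ≤ m) (hN : 2 * m ≤ N) {l : List (Side N)}
    {w : List Letter} (h : l.length = w.length) (hs : Simple l) (hl : l.length ≤ m) :
    prob (pairsOf l w) (fun ω => Escapes ω m l) ≤ 3 * m * returnBound N m := by
  have hnd := nodup_ends_pairsOf h hs
  have hA : (triangles l).card ≤ m := (card_triangles_le l).trans hl
  set S : Finset (Side N) :=
    Finset.univ.filter fun z => z.1 ∈ triangles l ∧ z ∉ ends (pairsOf l w) with hS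
  have hSc : S.card ≤ 3 * m := by
    refine (Finset.card_le_card (t := Finset.univ.filter fun z : Side N => z.1 ∈ triangles l)
      fun z hz => ?_).trans ?_
    · simp only [hS, Finset.mem_filter] at hz ⊢
      exact ⟨hz.1, hz.2.1⟩
    · rw [card_filter_fst_mem]
      omega
  have h1 : prob (pairsOf l w) (fun ω => Escapes ω m l) ≤
      prob (pairsOf l w) (fun ω => ∃ z ∈ S, Returns ω m (triangles l) z) := by
    refine prob_mono fun ω hω => ?_
    rintro ⟨z, hz1, hz2, hz3, hz4⟩
    refine ⟨z, ?_, hz4⟩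
    simp only [hS, Finset.mem_filter, Finset.mem_univ, true_and]
    exact ⟨hz1, notMem_ends_pairsOf ((mem_agreeing_pairsOf h).1 hω) hz2 hz3⟩
  refine h1.trans ((prob_exists_le S _ (δ := returnBound N m) fun z hz => ?_).trans ?_)
  · simp only [hS, Finset.mem_filter, Finset.mem_univ, true_and] at hz
    exact prob_returns_le hm hN hnd hz.2 hz.1 (fun e he => fst_mem_triangles_of_mem_ends h he)
      (by rwa [length_pairsOf h]) hA
  · refine mul_le_mul_of_nonneg_right ?_ (returnBound_nonneg N m)
    exact_mod_cast hSc

/-! ### Curves that avoid given triangles -/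

/-- The number of homotopy classes of simple curves of type `c` that avoid the triangles in `A`. -/
noncomputable def avoidingCount (A : Finset (Fin (2 * N))) (c : WordClass) (ω : Gluing N) : ℕ :=
  {l ∈ simpleCurves ω c | ∀ z ∈ l, z.1 ∉ A}.ncard / (2 * c.length)

theorem avoidingCount_force {m : ℕ} {x y : Side N} (hxy : x ≠ y) {A : Finset (Fin (2 * N))}
    (hx : x.1 ∈ A) (hy : y.1 ∈ A) {ω : Gluing N} (hrx : ¬ Returns ω m A x)
    (hry : ¬ Returns ω m A y) {c : WordClass} (hc : c.length ≤ m) :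
    avoidingCount A c (ω.force x y) = avoidingCount A c ω := by
  rw [avoidingCount, avoidingCount]
  congr 2
  have hstep : ∀ {l : List (Side N)} {z : Side N}, (∀ z ∈ l, z.1 ∉ A) → z ∈ l →
      IsTraced ω l → (ω.force x y).1 z = ω.1 z := by
    intro l z hA hz ht
    have h1 := hA z hz
    have h2 : (ω.1 z).1 ∉ A := by
      obtain ⟨u, hu, e⟩ := mem_triangles.1 (ht.apply_fst_mem_triangles hz)
      rw [← e]; exact hA u hu
    refine Gluing.force_apply_of_ne ω ?_ ?_ ?_ ?_
    · rintro rfl; exact h1 hx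
    · rintro rfl; exact h1 hy
    · rintro rfl; rw [ω.apply_apply] at h2; exact h2 hx
    · rintro rfl; rw [ω.apply_apply] at h2; exact h2 hy
  have htr : ∀ {l : List (Side N)} {w : List Letter}, (∀ z ∈ l, z.1 ∉ A) → IsTraced ω l →
      (Traces (ω.force x y) l w ↔ Traces ω l w) := by
    intro l w hA ht
    by_cases hlen : l.length = w.length
    · rw [← mem_agreeing_pairsOf hlen, ← mem_agreeing_pairsOf hlen, mem_agreeing, mem_agreeing]
      refine forall₂_congr fun p hp => ?_
      rw [hstep hA _ ht]
      rw [← map_fst_pairsOf hlen]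
      exact List.mem_map_of_mem hp
    · exact ⟨fun h => absurd h.1 hlen, fun h => absurd h.1 hlen⟩
  ext l
  constructor
  · rintro ⟨h, hA⟩
    have ht := (isTraced_of_mem_simpleCurves h).of_force hxy hx hy hA
      ((length_of_mem_simpleCurves h).trans_le hc) hrx hry
    obtain ⟨hs, w, hw, h⟩ := h
    exact ⟨⟨hs, w, hw, (htr hA ht).1 h⟩, hA⟩
  · rintro ⟨h, hA⟩
    have ht := isTraced_of_mem_simpleCurves h
    obtain ⟨hs, w, hw, h⟩ := h
    exact ⟨⟨hs, w, hw, (htr hA ht).2 h⟩, hA⟩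

theorem avoidingCount_eq_simpleCount {m : ℕ} {A : Finset (Fin (2 * N))} {ω : Gluing N}
    (h : ∀ s : Side N, s.1 ∈ A → ¬ Returns ω m A s) {c : WordClass} (hc : c.length ≤ m) :
    avoidingCount A c ω = simpleCount c ω := by
  rw [avoidingCount, simpleCount]
  congr 2
  ext l
  refine ⟨fun h => h.1, fun hl => ⟨hl, fun z hz hA => h z hA ?_⟩⟩
  exact (isTraced_of_mem_simpleCurves hl).returns hz hA
    ((length_of_mem_simpleCurves hl).trans_le hc)

theorem eq_of_mem_simpleCurves {ω : Gluing N} {c c' : WordClass} {l : List (Side N)}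
    (h : l ∈ simpleCurves ω c) (h' : l ∈ simpleCurves ω c') : c = c' := by
  obtain ⟨_, w, rfl, h⟩ := h
  obtain ⟨_, w', rfl, h'⟩ := h'
  rw [Subtype.ext (h.unique h')]

theorem simpleCount_eq_avoidingCount_add {m : ℕ} {ω : Gluing N} {a : List (Side N)}
    {c : WordClass} (ha : a ∈ simpleCurves ω c) (hesc : ¬ Escapes ω m a) {c' : WordClass}
    (hc' : c'.length ≤ m) :
    simpleCount c' ω = avoidingCount (triangles a) c' ω + if c' = c then 1 else 0 := by
  have hat := isTraced_of_mem_simpleCurves ha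
  have key : ∀ l ∈ simpleCurves ω c', ∀ z ∈ l, z.1 ∈ triangles a → l ∈ reparametrizations ω a :=
    fun l hl z hz hza => mem_reparametrizations.2
      (isRotated_of_not_escapes hat ha.1 (isTraced_of_mem_simpleCurves hl) hl.1
        ((length_of_mem_simpleCurves hl).trans_le hc') hesc hz hza)
  have hrep : ∀ l ∈ reparametrizations ω a, l ∈ simpleCurves ω c ∧
      ∀ z ∈ l, z.1 ∈ triangles a := by
    intro l hl
    obtain h | h := mem_reparametrizations.1 hl
    · refine ⟨mem_simpleCurves_of_isRotated ha h, fun z hz => ?_⟩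
      rw [← triangles_eq_of_isRotated h]
      exact mem_triangles.2 ⟨z, hz, rfl⟩
    · refine ⟨mem_simpleCurves_of_isRotated (revCurve_mem_simpleCurves ha) h, fun z hz => ?_⟩
      rw [← hat.triangles_revCurve, ← triangles_eq_of_isRotated h]
      exact mem_triangles.2 ⟨z, hz, rfl⟩
  rw [simpleCount, avoidingCount]
  by_cases hcc : c' = c
  · subst hcc
    rw [if_pos rfl]
    have hU : simpleCurves ω c' = {l ∈ simpleCurves ω c' | ∀ z ∈ l, z.1 ∉ triangles a} ∪
        (reparametrizations ω a : Set (List (Side N))) := by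
      ext l
      constructor
      · intro hl
        by_cases h : ∀ z ∈ l, z.1 ∉ triangles a
        · exact Or.inl ⟨hl, h⟩
        · push Not at h
          obtain ⟨z, hz, hza⟩ := h
          exact Or.inr (key l hl z hz hza)
      · rintro (h | h)
        · exact h.1
        · exact (hrep l h).1
    have hD : Disjoint {l ∈ simpleCurves ω c' | ∀ z ∈ l, z.1 ∉ triangles a}
        (reparametrizations ω a : Set (List (Side N))) := by
      rw [Set.disjoint_left]
      rintro l ⟨hl, h⟩ hr
      obtain ⟨z, hz⟩ := List.exists_mem_of_ne_nil _ (isTraced_of_mem_simpleCurves hl).1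
      exact h z hz ((hrep l hr).2 z hz)
    conv_lhs => rw [hU]
    rw [Set.ncard_union_eq hD ((finite_simpleCurves ω c').subset fun _ h => h.1)
      (Finset.finite_toSet _), Set.ncard_coe_finset, card_reparametrizations hat ha.1,
      length_of_mem_simpleCurves ha,
      Nat.add_div_right _ (Nat.mul_pos two_pos (length_pos c'))]
  · rw [if_neg hcc, add_zero]
    congr 2
    ext l
    refine ⟨fun hl => ⟨hl, fun z hz hza => hcc ?_⟩, fun h => h.1⟩
    exact eq_of_mem_simpleCurves hl (hrep l (key l hl z hz hza)).1

end Coupling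

/-! ### Coupling with a gluing that contains a given curve -/

section Approximation

open scoped Classical

variable {N : ℕ}

/-- The vector of the numbers of homotopy classes of simple curves. -/
noncomputable def simpleVector (W : Finset WordClass) (ω : Gluing N) : W → ℕ :=
  fun c => simpleCount c.1 ω

/-- The vector of the numbers of homotopy classes of simple curves that avoid `A`. -/
noncomputable def avoidingVector (W : Finset WordClass) (A : Finset (Fin (2 * N)))
    (ω : Gluing N) : W → ℕ :=
  fun c => avoidingCount A c.1 ω

theorem avg_cons {L : List (Side N × Side N)} {x y : Side N}
    (h : (ends ((x, y) :: L)).Nodup) (f : Gluing N → ℝ) :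
    avg ((x, y) :: L) f = avg L fun ω => f (ω.force x y) := by
  have hL : (ends L).Nodup := (List.nodup_cons.1 (List.nodup_cons.1 h).2).2
  have h1 := card_agreeing_pos hL
  rw [card_agreeing_cons h] at h1
  rw [avg, avg, sum_force h, card_agreeing_cons h, mul_div_mul_left]
  rintro h0
  rw [h0, zero_mul] at h1
  exact h1.false

theorem abs_avg_nil_sub_avg_le {W : Finset WordClass} {m : ℕ} (hm : 1 ≤ m) (hN : 2 * m ≤ N)
    (hW : ∀ c ∈ W, c.length ≤ m) {A : Finset (Fin (2 * N))} (hA : A.card ≤ m)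
    (F : (W → ℕ) → ℝ) (hF : ∀ z, |F z| ≤ 1) {L : List (Side N × Side N)} (hL : (ends L).Nodup)
    (hLA : ∀ e ∈ ends L, e.1 ∈ A) (hLm : L.length ≤ m) :
    |avg [] (fun ω => F (avoidingVector W A ω)) - avg L fun ω => F (avoidingVector W A ω)|
      ≤ L.length * (4 * returnBound N m) := by
  induction L with
  | nil => simp
  | cons p L ih =>
    obtain ⟨x, y⟩ := p
    have hnd := hL
    simp only [ends_cons, List.nodup_cons, List.mem_cons, not_or] at hnd
    obtain ⟨⟨hxy, hx⟩, hy, hL'⟩ := hnd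
    have hLA' : ∀ e ∈ ends L, e.1 ∈ A := fun e he => hLA e (by simp [he])
    have hxA : x.1 ∈ A := hLA x (by simp)
    have hyA : y.1 ∈ A := hLA y (by simp)
    rw [List.length_cons] at hLm
    have h1 := ih hL' hLA' (by omega)
    rw [avg_cons hL]
    have h2 := abs_avg_sub_avg_le hL' (fun ω => F (avoidingVector W A ω))
      (fun ω => F (avoidingVector W A (ω.force x y)))
      (fun ω => Returns ω m A x ∨ Returns ω m A y) (fun _ => hF _) (fun _ => hF _)
      (fun ω _ hω => by
        rw [not_or] at hω
        congr 1
        funext c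
        exact (avoidingCount_force hxy hxA hyA hω.1 hω.2 (hW c.1 c.2)).symm)
    have h3 := prob_or_le (L := L) (fun ω => Returns ω m A x) (fun ω => Returns ω m A y)
    have h4 := prob_returns_le hm hN hL' hx hxA hLA' (by omega) hA
    have h5 := prob_returns_le hm hN hL' hy hyA hLA' (by omega) hA
    refine (abs_sub_le _ _ _).trans ((add_le_add h1 h2).trans ?_)
    rw [List.length_cons]
    push_cast
    linarith

/-- Conditioning on a simple curve of type `c` amounts, up to a small error, to adding one curve of
this type. -/
theorem abs_avg_sub_avg_pairsOf_le {W : Finset WordClass} {m : ℕ} (hm : 1 ≤ m) (hN : 2 * m ≤ N)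
    (hW : ∀ c ∈ W, c.length ≤ m) (F : (W → ℕ) → ℝ) (hF : ∀ z, |F z| ≤ 1) (c : W)
    {a : List (Side N)} {w : Word} (has : Simple a) (hw : (⟦w⟧ : WordClass) = c.1)
    (hlen : a.length = w.1.length) :
    |avg (pairsOf a w.1) (fun ω => F (simpleVector W ω)) -
      avg [] (fun ω : Gluing N => F (simpleVector W ω + Pi.single c 1))| ≤ 16 * m * returnBound N m := by
  have ham : a.length ≤ m := by
    rw [hlen]
    have := hW c.1 c.2
    rwa [← hw] at this
  set A := triangles a with hA
  have hAm : A.card ≤ m := (card_triangles_le a).trans ham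
  have hnd := nodup_ends_pairsOf hlen has
  have hLm : (pairsOf a w.1).length ≤ m := by rwa [length_pairsOf hlen]
  have h1 := abs_avg_sub_avg_le (L := ([] : List (Side N × Side N))) (by simp)
    (fun ω => F (avoidingVector W A ω + Pi.single c 1))
    (fun ω => F (simpleVector W ω + Pi.single c 1))
    (fun ω => ∃ s ∈ Finset.univ.filter (fun s : Side N => s.1 ∈ A), Returns ω m A s)
    (fun _ => hF _) (fun _ => hF _) (fun ω _ hω => by
      push Not at hω
      congr 2
      funext d
      exact avoidingCount_eq_simpleCount (fun s hs => hω s (by simpa using hs)) (hW d.1 d.2))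
  have h2 := prob_exists_le (L := ([] : List (Side N × Side N)))
    (Finset.univ.filter (fun s : Side N => s.1 ∈ A))
    (fun s ω => Returns ω m A s) (δ := returnBound N m) (fun s hs => by
      simp only [Finset.mem_filter, Finset.mem_univ, true_and] at hs
      exact prob_returns_le hm hN (by simp) (by simp) hs (by simp) (by simp) hAm)
  rw [card_filter_fst_mem] at h2
  have h3 := abs_avg_nil_sub_avg_le hm hN hW hAm (fun z => F (z + Pi.single c 1))
    (fun _ => hF _) hnd (fun e he => fst_mem_triangles_of_mem_ends hlen he) hLm
  have h4 := abs_avg_sub_avg_le hnd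
    (fun ω => F (simpleVector W ω)) (fun ω => F (avoidingVector W A ω + Pi.single c 1))
    (fun ω => Escapes ω m a) (fun _ => hF _) (fun _ => hF _) (fun ω hω hesc => by
      congr 1
      funext d
      have ht := (mem_agreeing_pairsOf hlen).1 hω
      have := simpleCount_eq_avoidingCount_add (c := c.1) ⟨has, w, hw, ht⟩ hesc (hW d.1 d.2)
      simp only [simpleVector, avoidingVector, Pi.add_apply, this, hA, Pi.single_apply,
        Subtype.ext_iff])
  have h5 := prob_escapes_le hm hN hlen has ham
  have hr := returnBound_nonneg N m
  have h6 : ((3 * A.card : ℕ) : ℝ) * returnBound N m ≤ 3 * m * returnBound N m := by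
    refine mul_le_mul_of_nonneg_right ?_ hr
    exact_mod_cast Nat.mul_le_mul_left 3 hAm
  have h7 : ((pairsOf a w.1).length : ℝ) * (4 * returnBound N m) ≤ m * (4 * returnBound N m) := by
    refine mul_le_mul_of_nonneg_right ?_ (by linarith)
    exact_mod_cast hLm
  rw [abs_le] at h1 h3 h4 ⊢
  constructor <;> linarith [h1.1, h1.2, h3.1, h3.2, h4.1, h4.2]

/-! ### The number of configurations -/

/-- The lists of `k` sides of distinct triangles. -/
noncomputable def simpleLists (N k : ℕ) : Finset (List (Side N)) :=
  (List.finite_length_eq (Side N) k).toFinset.filter Simple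

theorem mem_simpleLists {k : ℕ} {l : List (Side N)} :
    l ∈ simpleLists N k ↔ l.length = k ∧ Simple l := by
  simp [simpleLists]

theorem card_simpleLists {k : ℕ} (hk : k ≤ 2 * N) :
    ((simpleLists N k).card : ℝ) = ∏ i ∈ Finset.range k, (6 * (N : ℝ) - 3 * i) := by
  have h1 : simpleLists N k = (Finset.univ : Finset ((Fin k ↪ Fin (2 * N)) × (Fin k → Fin 3))).image
      fun p => List.ofFn fun i => ((p.1 i, p.2 i) : Side N) := by
    ext l
    simp only [mem_simpleLists, Finset.mem_image, Finset.mem_univ, true_and]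
    constructor
    · rintro ⟨rfl, hs⟩
      refine ⟨⟨⟨fun i => l[i].1, fun i j hij => ?_⟩, fun i => l[i].2⟩, ?_⟩
      · have := hs.eq (List.getElem_mem _) (List.getElem_mem _) hij
        exact Fin.ext ((hs.nodup.getElem_inj_iff).1 this)
      · exact List.ofFn_getElem
    · rintro ⟨⟨e, f⟩, rfl⟩
      refine ⟨by simp, ?_⟩
      rw [Simple, List.map_ofFn, List.nodup_ofFn]
      exact e.injective
  rw [h1, Finset.card_image_of_injective]
  · rw [Finset.card_univ, Fintype.card_prod, Fintype.card_embedding_eq]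
    simp only [Fintype.card_fin, Fintype.card_pi, Finset.prod_const, Finset.card_univ]
    rw [Nat.descFactorial_eq_prod_range]
    push_cast
    have h3 : (3 : ℝ) ^ k = ∏ i ∈ Finset.range k, 3 := by simp
    rw [h3, ← Finset.prod_mul_distrib]
    refine Finset.prod_congr rfl fun i hi => ?_
    rw [Nat.cast_sub (by have := Finset.mem_range.1 hi; omega)]
    push_cast
    ring
  · rintro ⟨e, f⟩ ⟨e', f'⟩ h
    have h' := List.ofFn_injective h
    have h2 : ∀ i, e i = e' i ∧ f i = f' i := fun i => by
      have := congrFun h' i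
      simpa using this
    exact Prod.ext (DFunLike.ext _ _ fun i => (h2 i).1) (funext fun i => (h2 i).2)

/-- The expected number of lists of `k` sides that trace a given word. -/
noncomputable def expectedTraces (N k : ℕ) : ℝ :=
  (simpleLists N k).card / ∏ i ∈ Finset.range k, (6 * (N : ℝ) - 1 - 2 * i)

theorem abs_expectedTraces_sub_one_le {k m : ℕ} (hm : 1 ≤ m) (hk : k ≤ m) (hN : 2 * m ≤ N)
    (hmN : m ^ 2 ≤ N) : |expectedTraces N k - 1| ≤ m ^ 2 / N := by
  have hm' : (1 : ℝ) ≤ m := by exact_mod_cast hm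
  have hN' : 2 * (m : ℝ) ≤ N := by exact_mod_cast hN
  have hmN' : (m : ℝ) ^ 2 ≤ N := by exact_mod_cast hmN
  have hk' : (k : ℝ) ≤ m := by exact_mod_cast hk
  have hN0 : (0 : ℝ) < N := by linarith
  rw [expectedTraces, card_simpleLists (by omega), ← Finset.prod_div_distrib]
  have hden : ∀ i ∈ Finset.range k, 3 * (N : ℝ) ≤ 6 * N - 1 - 2 * i := by
    intro i hi
    have : (i : ℝ) ≤ k := by exact_mod_cast (Finset.mem_range.1 hi).le
    linarith
  have h1 : ∏ i ∈ Finset.range k, (6 * (N : ℝ) - 3 * i) / (6 * (N : ℝ) - 1 - 2 * i)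
      = ∏ i ∈ Finset.range k, (1 + (1 - (i : ℝ)) / (6 * (N : ℝ) - 1 - 2 * i)) := by
    refine Finset.prod_congr rfl fun i hi => ?_
    have := hden i hi
    have : (6 * (N : ℝ) - 1 - 2 * i) ≠ 0 := by linarith
    rw [one_add_div this]
    congr 1
    ring
  rw [h1]
  have h2 := Finset.norm_prod_one_add_sub_one_le (Finset.range k)
    fun i : ℕ => (1 - (i : ℝ)) / (6 * (N : ℝ) - 1 - 2 * i)
  have h3 : ∑ i ∈ Finset.range k, ‖(1 - (i : ℝ)) / (6 * (N : ℝ) - 1 - 2 * i)‖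
      ≤ m ^ 2 / (3 * N) := by
    calc ∑ i ∈ Finset.range k, ‖(1 - (i : ℝ)) / (6 * (N : ℝ) - 1 - 2 * i)‖
        ≤ ∑ i ∈ Finset.range k, (m : ℝ) / (3 * N) := by
          refine Finset.sum_le_sum fun i hi => ?_
          have hd := hden i hi
          have hi' : (i : ℝ) ≤ k := by exact_mod_cast (Finset.mem_range.1 hi).le
          have hi0 : (0 : ℝ) ≤ i := by positivity
          rw [norm_div, Real.norm_eq_abs, Real.norm_eq_abs,
            abs_of_pos (by linarith : (0 : ℝ) < 6 * N - 1 - 2 * i)]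
          refine div_le_div₀ (by linarith) ?_ (by linarith) hd
          rw [abs_le]; constructor <;> linarith
      _ = k * (m / (3 * N)) := by simp
      _ ≤ m * (m / (3 * N)) := mul_le_mul_of_nonneg_right hk' (by positivity)
      _ = _ := by ring
  set x : ℝ := ∑ i ∈ Finset.range k, ‖(1 - (i : ℝ)) / (6 * (N : ℝ) - 1 - 2 * i)‖
  have hx0 : 0 ≤ x := Finset.sum_nonneg fun _ _ => norm_nonneg _
  have h4 : (m : ℝ) ^ 2 / (3 * N) ≤ 1 := by
    rw [div_le_one (by linarith)]; linarith
  have h5 := Real.abs_exp_sub_one_le (x := x) (by rw [abs_of_nonneg hx0]; linarith)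
  rw [abs_of_nonneg hx0] at h5
  rw [Real.norm_eq_abs] at h2
  have h6 : (m : ℝ) ^ 2 / N = 3 * (m ^ 2 / (3 * N)) := by field_simp
  have h7 : 0 ≤ (m : ℝ) ^ 2 / (3 * N) := by positivity
  linarith [le_abs_self (Real.exp x - 1)]

theorem finite_class (c : WordClass) : {w : Word | (⟦w⟧ : WordClass) = c}.Finite := by
  have h := ((Set.finite_singleton Letter.L).insert Letter.R)
  have hL : Finite Letter := by
    refine Set.finite_univ_iff.1 (h.subset fun a _ => ?_)
    cases a <;> simp
  refine Set.Finite.of_finite_image (f := Subtype.val)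
    ((List.finite_length_eq Letter c.length).subset ?_) Subtype.val_injective.injOn
  rintro _ ⟨w, rfl, rfl⟩
  rfl

/-- The words in a class. -/
noncomputable def classWords (c : WordClass) : Finset Word := (finite_class c).toFinset

theorem mem_classWords {c : WordClass} {w : Word} : w ∈ classWords c ↔ (⟦w⟧ : WordClass) = c := by
  simp [classWords]

theorem card_classWords (c : WordClass) : (classWords c).card = c.card :=
  (Set.ncard_eq_toFinset_card _ (finite_class c)).symm

theorem card_le_two_mul_length (c : WordClass) : c.card ≤ 2 * c.length := by
  rw [← card_classWords]
  induction c using Quotient.inductionOn with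
  | h w =>
    have h1 : (classWords ⟦w⟧).image Subtype.val ⊆
        w.1.cyclicPermutations.toFinset ∪ (flipWord w.1).cyclicPermutations.toFinset := by
      intro v hv
      obtain ⟨u, hu, rfl⟩ := Finset.mem_image.1 hv
      rw [Finset.mem_union, List.mem_toFinset, List.mem_toFinset,
        List.mem_cyclicPermutations_iff, List.mem_cyclicPermutations_iff]
      have : u.1 ~r w.1 ∨ flipWord u.1 ~r w.1 := Quotient.exact (mem_classWords.1 hu)
      refine this.imp_right fun h => ?_
      have := flipWord_isRotated h
      rwa [flipWord_flipWord] at this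
    have h2 := (Finset.card_le_card h1).trans (Finset.card_union_le _ _)
    rw [Finset.card_image_of_injective _ Subtype.val_injective] at h2
    refine h2.trans ((add_le_add (List.toFinset_card_le _) (List.toFinset_card_le _)).trans ?_)
    rw [List.length_cyclicPermutations_of_ne_nil _ w.2,
      List.length_cyclicPermutations_of_ne_nil (flipWord w.1) (map_reverse_ne_nil w.2 _)]
    simp only [flipWord, List.length_reverse, List.length_map, WordClass.length, Quotient.lift_mk]
    omega

theorem mean_le_one (c : WordClass) : c.mean ≤ 1 := by
  rw [WordClass.mean]
  refine div_le_one_of_le₀ ?_ (by positivity)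
  exact_mod_cast card_le_two_mul_length c

theorem ncard_simpleCurves_eq (c : WordClass) (ω : Gluing N) : (simpleCurves ω c).ncard =
    ((simpleLists N c.length ×ˢ classWords c).filter
      fun p => ω ∈ agreeing (pairsOf p.1 p.2.1)).card := by
  have hlen : ∀ p ∈ simpleLists N c.length ×ˢ classWords c, p.1.length = p.2.1.length := by
    rintro ⟨l, w⟩ hp
    rw [Finset.mem_product, mem_simpleLists, mem_classWords] at hp
    obtain ⟨⟨h1, _⟩, rfl⟩ := hp
    exact h1
  have h1 : simpleCurves ω c = (((simpleLists N c.length ×ˢ classWords c).filter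
      fun p => ω ∈ agreeing (pairsOf p.1 p.2.1)).image Prod.fst : Finset _) := by
    ext l
    rw [Finset.mem_coe, Finset.mem_image]
    constructor
    · rintro hl
      have hk := length_of_mem_simpleCurves hl
      obtain ⟨hs, w, hw, ht⟩ := hl
      refine ⟨(l, w), Finset.mem_filter.2 ⟨Finset.mem_product.2
        ⟨mem_simpleLists.2 ⟨hk, hs⟩, mem_classWords.2 hw⟩, (mem_agreeing_pairsOf ht.1).2 ht⟩, rfl⟩
    · rintro ⟨⟨l', w⟩, hp, rfl⟩
      rw [Finset.mem_filter] at hp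
      have ht := (mem_agreeing_pairsOf (hlen _ hp.1)).1 hp.2
      rw [Finset.mem_product, mem_simpleLists, mem_classWords] at hp
      exact ⟨hp.1.1.2, w, hp.1.2, ht⟩
  rw [h1, Set.ncard_coe_finset, Finset.card_image_of_injOn]
  rintro ⟨l, w⟩ hp ⟨l', w'⟩ hp' (rfl : l = l')
  rw [Finset.mem_coe, Finset.mem_filter] at hp hp'
  have ht := (mem_agreeing_pairsOf (hlen _ hp.1)).1 hp.2
  have ht' := (mem_agreeing_pairsOf (hlen _ hp'.1)).1 hp'.2
  exact Prod.ext rfl (Subtype.ext (ht.unique ht'))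

theorem sum_agreeing_eq {l : List (Side N)} {w : List Letter} (h : l.length = w.length)
    (hs : Simple l) (f : Gluing N → ℝ) : ∑ ω ∈ agreeing (pairsOf l w), f ω =
      Fintype.card (Gluing N) / (∏ i ∈ Finset.range l.length, (6 * (N : ℝ) - 1 - 2 * i))
        * avg (pairsOf l w) f := by
  have hnd := nodup_ends_pairsOf h hs
  have h1 := card_agreeing hnd
  have h2 := card_agreeing_pos hnd
  have h3 := card_gluing_pos N
  rw [length_pairsOf h] at h1
  have h4 : (∏ i ∈ Finset.range l.length, (6 * (N : ℝ) - 1 - 2 * i)) ≠ 0 := by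
    intro h0; rw [h0, zero_mul] at h1; exact h3.ne' h1
  rw [avg, h1]
  field_simp

/-- The Stein identities of the Poisson law hold approximately for the numbers of simple curves. -/
theorem abs_stein_le {W : Finset WordClass} {m : ℕ} (hm : 1 ≤ m) (hN : 2 * m ≤ N)
    (hmN : m ^ 2 ≤ N) (hW : ∀ c ∈ W, c.length ≤ m) (c : W) (F : (W → ℕ) → ℝ)
    (hF : ∀ z, |F z| ≤ 1) :
    |(∑ ω : Gluing N, (simpleVector W ω c : ℝ) * F (simpleVector W ω)) -
      c.1.mean * ∑ ω : Gluing N, F (simpleVector W ω + Pi.single c 1)|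
        ≤ (32 * m * returnBound N m + m ^ 2 / N) * Fintype.card (Gluing N) := by
  set k := c.1.length with hk
  set G : ℝ := (Fintype.card (Gluing N) : ℝ) with hG
  set E := avg [] (fun ω : Gluing N => F (simpleVector W ω + Pi.single c 1)) with hE
  set Q : ℝ := ∏ i ∈ Finset.range k, (6 * (N : ℝ) - 1 - 2 * i) with hQ
  set P := simpleLists N k ×ˢ classWords c.1 with hP
  have hG0 : 0 < G := card_gluing_pos N
  have hk0 : (0 : ℝ) < k := by exact_mod_cast length_pos c.1
  have hr := returnBound_nonneg N m
  have hkm : k ≤ m := hW c.1 c.2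
  have hPmem : ∀ p ∈ P, p.1.length = k ∧ Simple p.1 ∧ (⟦p.2⟧ : WordClass) = c.1 ∧
      p.1.length = p.2.1.length := by
    rintro ⟨l, w⟩ hp
    rw [hP, Finset.mem_product, mem_simpleLists, mem_classWords] at hp
    refine ⟨hp.1.1, hp.1.2, hp.2, hp.1.1.trans ?_⟩
    rw [hk, ← hp.2]; rfl
  have hEsum : ∑ ω : Gluing N, F (simpleVector W ω + Pi.single c 1) = G * E := by
    rw [hE, avg, agreeing_nil, Finset.card_univ, mul_div_cancel₀ _ hG0.ne']
  have hE1 : |E| ≤ 1 := by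
    have h1 : |∑ ω : Gluing N, F (simpleVector W ω + Pi.single c 1)| ≤ G := by
      refine (Finset.abs_sum_le_sum_abs _ _).trans ((Finset.sum_le_sum fun ω _ => hF _).trans ?_)
      simp [hG]
    rw [hEsum, abs_mul, abs_of_pos hG0] at h1
    exact le_of_mul_le_mul_left (by linarith) hG0
  have hsum : 2 * (k : ℝ) * ∑ ω : Gluing N, (simpleVector W ω c : ℝ) * F (simpleVector W ω)
      = ∑ p ∈ P, G / Q * avg (pairsOf p.1 p.2.1) fun ω => F (simpleVector W ω) := by
    have h1 : ∀ ω : Gluing N, 2 * (k : ℝ) * ((simpleVector W ω c : ℝ) * F (simpleVector W ω)) =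
        ∑ p ∈ P, if ω ∈ agreeing (pairsOf p.1 p.2.1) then F (simpleVector W ω) else 0 := by
      intro ω
      have h2 := two_mul_length_mul_simpleCount c.1 ω
      rw [ncard_simpleCurves_eq] at h2
      have h3 : 2 * (k : ℝ) * (simpleVector W ω c : ℝ) =
          (P.filter fun p => ω ∈ agreeing (pairsOf p.1 p.2.1)).card := by
        rw [← h2]; push_cast; rfl
      rw [← mul_assoc, h3, ← Finset.sum_filter, Finset.sum_const, nsmul_eq_mul]
    rw [Finset.mul_sum, Finset.sum_congr rfl fun ω _ => h1 ω, Finset.sum_comm]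
    refine Finset.sum_congr rfl fun p hp => ?_
    obtain ⟨hpk, hps, _, hpl⟩ := hPmem p hp
    have := sum_agreeing_eq hpl hps fun ω => F (simpleVector W ω)
    rw [hpk] at this
    rw [← this, ← Finset.sum_filter]
    congr 1
    ext ω
    simp
  have hPcard : (P.card : ℝ) = (simpleLists N k).card * c.1.card := by
    rw [hP, Finset.card_product, card_classWords]; push_cast; rfl
  have hQ0 : 0 < Q := by
    refine Finset.prod_pos fun i hi => ?_
    have h1 : (i : ℝ) + 1 ≤ k := by exact_mod_cast Finset.mem_range.1 hi
    have h2 : (k : ℝ) ≤ m := by exact_mod_cast hkm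
    have h3 : 2 * (m : ℝ) ≤ N := by exact_mod_cast hN
    linarith
  have hρ := abs_expectedTraces_sub_one_le (N := N) hm hkm hN hmN
  set ρ := expectedTraces N k with hρdef
  have hPρ : (P.card : ℝ) * (G / Q) = c.1.card * G * ρ := by
    rw [hPcard, hρdef, expectedTraces]; ring
  set u : ℝ := m ^ 2 / N with hu
  have hu1 : u ≤ 1 := by
    have h1 : (0 : ℝ) < N := by exact_mod_cast (by omega : 0 < N)
    rw [hu, div_le_one h1]
    exact_mod_cast hmN
  have hρ2 : ρ ≤ 2 := by linarith [(abs_le.1 hρ).2]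
  have hdiff : |∑ p ∈ P, G / Q * avg (pairsOf p.1 p.2.1) (fun ω => F (simpleVector W ω))
      - P.card * (G / Q) * E| ≤ P.card * (G / Q) * (16 * m * returnBound N m) := by
    rw [mul_assoc, ← nsmul_eq_mul, ← Finset.sum_const, ← Finset.sum_sub_distrib]
    refine (Finset.abs_sum_le_sum_abs _ _).trans ?_
    rw [mul_assoc, ← nsmul_eq_mul, ← Finset.sum_const]
    refine Finset.sum_le_sum fun p hp => ?_
    obtain ⟨hpk, hps, hpw, hpl⟩ := hPmem p hp
    rw [← mul_sub, abs_mul, abs_of_pos (div_pos hG0 hQ0)]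
    exact mul_le_mul_of_nonneg_left
      (abs_avg_sub_avg_pairsOf_le hm hN hW F hF c hps hpw hpl) (div_pos hG0 hQ0).le
  have hcard : (c.1.card : ℝ) ≤ 2 * k := by exact_mod_cast card_le_two_mul_length c.1
  have hmean : (2 * (k : ℝ)) * (c.1.mean : ℝ) = c.1.card := by
    rw [WordClass.mean]
    push_cast
    rw [← hk]
    field_simp
  rw [hEsum]
  set S := ∑ ω : Gluing N, (simpleVector W ω c : ℝ) * F (simpleVector W ω)
  set η := 16 * m * returnBound N m with hη
  have hη0 : 0 ≤ η := by positivity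
  rw [← hsum, hPρ] at hdiff
  have h1 : |2 * (k : ℝ) * S - c.1.card * G * E| ≤ c.1.card * G * (2 * η + u) := by
    have hcG : (0 : ℝ) ≤ c.1.card * G := by positivity
    have h2 : |c.1.card * G * ρ * E - c.1.card * G * E| ≤ c.1.card * G * u := by
      rw [show c.1.card * G * ρ * E - c.1.card * G * E = c.1.card * G * ((ρ - 1) * E) by ring,
        abs_mul, abs_of_nonneg hcG, abs_mul]
      refine mul_le_mul_of_nonneg_left ?_ hcG
      calc |ρ - 1| * |E| ≤ u * 1 := mul_le_mul hρ hE1 (abs_nonneg _) (by positivity)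
        _ = u := mul_one u
    have h3 : c.1.card * G * ρ * η ≤ c.1.card * G * (2 * η) := by
      rw [mul_assoc]
      exact mul_le_mul_of_nonneg_left (mul_le_mul_of_nonneg_right hρ2 hη0) hcG
    refine (abs_sub_le _ _ _).trans ((add_le_add hdiff h2).trans ?_)
    linarith
  have h4 : 2 * (k : ℝ) * S - c.1.card * G * E = 2 * k * (S - c.1.mean * (G * E)) := by
    rw [← hmean]; ring
  rw [h4, abs_mul, abs_of_pos (by linarith : (0 : ℝ) < 2 * k)] at h1
  have h5 : c.1.card * G * (2 * η + u) ≤ 2 * k * (G * (2 * η + u)) := by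
    rw [mul_assoc]
    exact mul_le_mul_of_nonneg_right hcard (by positivity)
  have h6 := le_of_mul_le_mul_left (h1.trans h5) (by linarith : (0 : ℝ) < 2 * k)
  refine h6.trans (le_of_eq ?_)
  rw [hη]; ring

end Approximation

/-! ### Tangled gluings are rare -/

section Main

open scoped Classical

variable {N : ℕ}

/-- The words of a given length. -/
noncomputable def wordsOfLength (k : ℕ) : Finset (List Letter) :=
  (Finset.univ : Finset (Fin k → Bool)).image
    fun f => List.ofFn fun i => if f i then Letter.L else Letter.R

theorem card_wordsOfLength_le (k : ℕ) : (wordsOfLength k).card ≤ 2 ^ k := by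
  refine Finset.card_image_le.trans ?_
  simp

theorem mem_wordsOfLength {k : ℕ} {w : List Letter} : w ∈ wordsOfLength k ↔ w.length = k := by
  simp only [wordsOfLength, Finset.mem_image, Finset.mem_univ, true_and]
  constructor
  · rintro ⟨f, rfl⟩
    simp
  · rintro rfl
    refine ⟨fun i => decide (w[i] = Letter.L), List.ext_getElem (by simp) fun i h1 h2 => ?_⟩
    simp only [List.getElem_ofFn, decide_eq_true_eq, Fin.getElem_fin]
    rcases w[i] with _ | _ <;> simp

theorem card_tangled_le {m : ℕ} (hm : 1 ≤ m) (hN : 2 * m ≤ N) (hmN : m ^ 2 ≤ N) :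
    ((Finset.univ.filter fun ω : Gluing N => Tangled ω m).card : ℝ)
      ≤ 6 * m ^ 2 * 2 ^ m * returnBound N m * Fintype.card (Gluing N) := by
  set G : ℝ := (Fintype.card (Gluing N) : ℝ) with hG
  have hG0 : 0 < G := card_gluing_pos N
  have hr := returnBound_nonneg N m
  let T : ℕ → Finset (Gluing N) := fun k => (wordsOfLength k).biUnion fun w =>
    (simpleLists N k).biUnion fun l => (agreeing (pairsOf l w)).filter fun ω => Escapes ω m l
  have hsub : (Finset.univ.filter fun ω : Gluing N => Tangled ω m) ⊆
      (Finset.Icc 1 m).biUnion T := by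
    intro ω hω
    obtain ⟨a, ha, has, ham, hesc⟩ := (Finset.mem_filter.1 hω).2
    obtain ⟨w, hw, ht⟩ := ha.exists_traces
    refine Finset.mem_biUnion.2 ⟨a.length, Finset.mem_Icc.2
      ⟨List.length_pos_of_ne_nil ha.1, ham⟩, Finset.mem_biUnion.2 ⟨w, mem_wordsOfLength.2 ht.1.symm,
      Finset.mem_biUnion.2 ⟨a, mem_simpleLists.2 ⟨rfl, has⟩,
        Finset.mem_filter.2 ⟨(mem_agreeing_pairsOf ht.1).2 ht, hesc⟩⟩⟩⟩
  have hT : ∀ k ∈ Finset.Icc 1 m, ((T k).card : ℝ) ≤ 6 * m * 2 ^ m * returnBound N m * G := by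
    intro k hk
    rw [Finset.mem_Icc] at hk
    set Q : ℝ := ∏ i ∈ Finset.range k, (6 * (N : ℝ) - 1 - 2 * i) with hQ
    have h1 : ∀ w ∈ wordsOfLength k, ∀ l ∈ simpleLists N k,
        (((agreeing (pairsOf l w)).filter fun ω => Escapes ω m l).card : ℝ)
          ≤ G / Q * (3 * m * returnBound N m) := by
      intro w hw l hl
      rw [mem_wordsOfLength] at hw
      rw [mem_simpleLists] at hl
      have hlen : l.length = w.length := hl.1.trans hw.symm
      have h2 := prob_escapes_le hm hN hlen hl.2 (hl.1.trans_le hk.2)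
      have h3 := card_agreeing_pos (nodup_ends_pairsOf hlen hl.2)
      have h4 := card_agreeing (nodup_ends_pairsOf hlen hl.2)
      rw [length_pairsOf hlen, hl.1, ← hQ, ← hG] at h4
      have hQ0 : Q ≠ 0 := by
        intro h0; rw [h0, zero_mul] at h4; exact hG0.ne' h4
      rw [prob, div_le_iff₀ h3] at h2
      refine h2.trans (le_of_eq ?_)
      rw [h4]
      field_simp
    have h2 : ((T k).card : ℝ) ≤ ∑ w ∈ wordsOfLength k, ∑ l ∈ simpleLists N k,
        (((agreeing (pairsOf l w)).filter fun ω => Escapes ω m l).card : ℝ) := by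
      exact_mod_cast Finset.card_biUnion_le.trans
        (Finset.sum_le_sum fun w _ => Finset.card_biUnion_le)
    have h3 : ∑ w ∈ wordsOfLength k, ∑ l ∈ simpleLists N k,
        (((agreeing (pairsOf l w)).filter fun ω => Escapes ω m l).card : ℝ) ≤
        (wordsOfLength k).card * (expectedTraces N k * G * (3 * m * returnBound N m)) := by
      refine (Finset.sum_le_sum fun w hw => Finset.sum_le_sum fun l hl => h1 w hw l hl).trans ?_
      rw [Finset.sum_const, Finset.sum_const, nsmul_eq_mul, nsmul_eq_mul, expectedTraces, ← hQ]
      refine le_of_eq ?_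
      ring
    have h4 := abs_expectedTraces_sub_one_le (N := N) hm hk.2 hN hmN
    have h5 : (m : ℝ) ^ 2 / N ≤ 1 := by
      have h1 : (0 : ℝ) < N := by exact_mod_cast (by omega : 0 < N)
      rw [div_le_one h1]
      exact_mod_cast hmN
    have h6 : expectedTraces N k ≤ 2 := by linarith [(abs_le.1 h4).2]
    have h7 : ((wordsOfLength k).card : ℝ) ≤ 2 ^ m := by
      exact_mod_cast (card_wordsOfLength_le k).trans (Nat.pow_le_pow_right two_pos hk.2)
    calc ((T k).card : ℝ)
        ≤ (wordsOfLength k).card * (expectedTraces N k * G * (3 * m * returnBound N m)) :=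
          h2.trans h3
      _ ≤ (wordsOfLength k).card * (2 * G * (3 * m * returnBound N m)) := by gcongr
      _ ≤ 2 ^ m * (2 * G * (3 * m * returnBound N m)) := by gcongr
      _ = _ := by ring
  have h1 : ((Finset.univ.filter fun ω : Gluing N => Tangled ω m).card : ℝ) ≤
      ∑ k ∈ Finset.Icc 1 m, ((T k).card : ℝ) := by
    exact_mod_cast (Finset.card_le_card hsub).trans Finset.card_biUnion_le
  refine h1.trans ((Finset.sum_le_sum hT).trans (le_of_eq ?_))
  simp only [Finset.sum_const, Nat.card_Icc, nsmul_eq_mul, Nat.add_sub_cancel]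
  ring

/-! ### Total variation distance -/

theorem gluingMeasure_map_real {ι : Type*} (X : Gluing N → ι → ℕ) (hX : Measurable X)
    {B : Set (ι → ℕ)} (hB : MeasurableSet B) : ((gluingMeasure N).map X).real B =
      ((Finset.univ.filter fun ω => X ω ∈ B).card : ℝ) / Fintype.card (Gluing N) := by
  rw [Measure.real, Measure.map_apply hX hB, gluingMeasure, uniformOn_univ,
    ENNReal.toReal_div, Measure.count_apply_finite _ (Set.toFinite _)]
  simp only [ENNReal.toReal_natCast]
  congr 3
  ext ω
  simp

theorem isProbabilityMeasure_gluingMeasure (N : ℕ) : IsProbabilityMeasure (gluingMeasure N) := by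
  have := Gluing.nonempty N
  exact isProbabilityMeasure_uniformOn Set.finite_univ Set.univ_nonempty

theorem dmTV_le_one {ι : Type*} (μ ν : Measure (ι → ℕ)) [IsProbabilityMeasure μ]
    [IsProbabilityMeasure ν] : dmTV μ ν ≤ 1 := by
  refine ciSup_le fun B => ?_
  have h1 : μ.real B ≤ 1 := measureReal_le_one
  have h2 : ν.real B ≤ 1 := measureReal_le_one
  have h3 : 0 ≤ μ.real B := measureReal_nonneg
  have h4 : 0 ≤ ν.real B := measureReal_nonneg
  rw [abs_le]
  constructor <;> linarith

theorem dmTV_le_of_large {W : Finset WordClass} {m : ℕ} (hm : 1 ≤ m) (hN : 2 * m ≤ N)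
    (hmN : m ^ 2 ≤ N) (hW : ∀ c ∈ W, c.length ≤ m) :
    dmTV ((gluingMeasure N).map (countVector W N)) (poissonVector W) ≤
      6 * m ^ 2 * 2 ^ m * returnBound N m +
        2 * W.card * (32 * m * returnBound N m + m ^ 2 / N) := by
  refine ciSup_le fun B => ?_
  have hne := Gluing.nonempty N
  have hG0 := card_gluing_pos N
  rw [gluingMeasure_map_real _ Measurable.of_discrete MeasurableSet.of_discrete]
  have h1 := abs_prob_sub_pi_poisson_le (simpleVector (N := N) W) (fun c : W => c.1.mean)
    (fun c => mean_le_one c.1) _ (fun c F hF => abs_stein_le hm hN hmN hW c F hF) B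
  rw [Fintype.card_coe] at h1
  have h01 : ∀ (p : Prop), 0 ≤ (if p then (1 : ℝ) else 0) ∧ (if p then (1 : ℝ) else 0) ≤ 1 := by
    intro p; split_ifs <;> norm_num
  have hEq : ∀ ω, ¬ Tangled ω m → countVector W N ω = simpleVector W ω := fun ω hω =>
    funext fun c => geodesicCount_eq_simpleCount hω (hW c.1 c.2)
  have h2 : |((Finset.univ.filter fun ω => countVector W N ω ∈ B).card : ℝ)
      - (Finset.univ.filter fun ω : Gluing N => simpleVector W ω ∈ B).card| ≤
      (Finset.univ.filter fun ω : Gluing N => Tangled ω m).card := by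
    rw [Finset.card_filter, Finset.card_filter, Finset.card_filter]
    push_cast
    rw [← Finset.sum_sub_distrib]
    refine (Finset.abs_sum_le_sum_abs _ _).trans (Finset.sum_le_sum fun ω _ => ?_)
    by_cases hω : Tangled ω m
    · rw [if_pos hω, abs_le]
      constructor <;>
        linarith [(h01 (countVector W N ω ∈ B)).1, (h01 (countVector W N ω ∈ B)).2,
          (h01 (simpleVector W ω ∈ B)).1, (h01 (simpleVector W ω ∈ B)).2]
    · rw [hEq ω hω]
      simp [hω]
  have h3 : |((Finset.univ.filter fun ω => countVector W N ω ∈ B).card : ℝ) / Fintype.card (Gluing N)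
      - ((Finset.univ.filter fun ω : Gluing N => simpleVector W ω ∈ B).card : ℝ) /
        Fintype.card (Gluing N)| ≤ 6 * m ^ 2 * 2 ^ m * returnBound N m := by
    rw [← sub_div, abs_div, abs_of_pos hG0, div_le_iff₀ hG0]
    exact h2.trans (card_tangled_le hm hN hmN)
  exact (abs_sub_le _ _ _).trans (add_le_add h3 h1)

theorem error_le {m : ℕ} (hm : 1 ≤ m) {N : ℕ} (hN : 1 ≤ N) {v : ℝ} (hv : 1 ≤ v) :
    6 * m ^ 2 * 2 ^ m * returnBound N m + 2 * v * (32 * m * returnBound N m + m ^ 2 / N) ≤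
      18 * v ^ 3 * (6 * (m : ℝ)) ^ (3 * m + 4) * (1 / (N : ℝ)) := by
  have hm' : (1 : ℝ) ≤ m := by exact_mod_cast hm
  have hN' : (1 : ℝ) ≤ N := by exact_mod_cast hN
  set p : ℝ := 2 ^ m with hp
  have hp1 : 1 ≤ p := one_le_pow₀ (by norm_num)
  set x : ℝ := (m : ℝ)
  have hx2 : 1 ≤ x ^ 2 := one_le_pow₀ hm'
  have hpow : p ^ 2 * (1296 * x ^ 4) ≤ (6 * x) ^ (3 * m + 4) := by
    have h1 : p ^ 2 ≤ (6 * x) ^ (3 * m) := by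
      rw [hp, ← pow_mul, mul_comm m 2]
      calc (2 : ℝ) ^ (2 * m) ≤ (6 * x) ^ (2 * m) := pow_le_pow_left₀ (by norm_num) (by linarith) _
        _ ≤ (6 * x) ^ (3 * m) := pow_le_pow_right₀ (by linarith) (by omega)
    rw [pow_add]
    have h2 : 1296 * x ^ 4 = (6 * x) ^ 4 := by ring
    rw [← h2]
    exact mul_le_mul_of_nonneg_right h1 (by positivity)
  have hv3 : v ≤ v ^ 3 := by
    have : 1 ≤ v ^ 2 := one_le_pow₀ hv
    nlinarith
  have hA : 6 * x ^ 2 * p * (p * (x + 1) * (2 * x)) ≤ v * (24 * (p ^ 2 * x ^ 4)) := by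
    have h1 : 6 * x ^ 2 * p * (p * (x + 1) * (2 * x)) ≤ 24 * (p ^ 2 * x ^ 4) := by
      have : p ^ 2 * x ^ 3 * (x + 1) ≤ p ^ 2 * x ^ 3 * (2 * x) :=
        mul_le_mul_of_nonneg_left (by linarith) (by positivity)
      linarith
    exact h1.trans (le_mul_of_one_le_left (by positivity) hv)
  have hp2 : p ≤ p ^ 2 := by nlinarith
  have hB : 2 * v * (32 * x * (p * (x + 1) * (2 * x)) + x ^ 2) ≤ v * (258 * (p ^ 2 * x ^ 4)) := by
    have h1 : p * x ^ 2 * (x + 1) ≤ p ^ 2 * x ^ 2 * (2 * x ^ 2) := by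
      have : x + 1 ≤ 2 * x ^ 2 := by nlinarith
      gcongr
    have h2 : x ^ 2 ≤ p ^ 2 * x ^ 4 := by
      have h3 : 1 ≤ p ^ 2 := one_le_pow₀ hp1
      calc x ^ 2 = 1 * (x ^ 2 * 1) := by ring
        _ ≤ p ^ 2 * (x ^ 2 * x ^ 2) := by gcongr
        _ = _ := by ring
    have h3 : 64 * (p * x ^ 2 * (x + 1)) + x ^ 2 ≤ 129 * (p ^ 2 * x ^ 4) := by linarith
    have h4 := mul_le_mul_of_nonneg_left h3 (by linarith : (0 : ℝ) ≤ 2 * v)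
    linarith
  have hmain : 6 * x ^ 2 * p * (p * (x + 1) * (2 * x)) +
      2 * v * (32 * x * (p * (x + 1) * (2 * x)) + x ^ 2) ≤ 18 * v ^ 3 * (6 * x) ^ (3 * m + 4) := by
    have h1 : v * (p ^ 2 * (1296 * x ^ 4)) ≤ v ^ 3 * (6 * x) ^ (3 * m + 4) :=
      mul_le_mul hv3 hpow (by positivity) (by positivity)
    have h2 : 0 ≤ v * (p ^ 2 * x ^ 4) := by positivity
    linarith
  have e : 6 * x ^ 2 * p * returnBound N m + 2 * v * (32 * x * returnBound N m + x ^ 2 / N) =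
      (6 * x ^ 2 * p * (p * (x + 1) * (2 * x)) +
      2 * v * (32 * x * (p * (x + 1) * (2 * x)) + x ^ 2)) * (1 / (N : ℝ)) := by
    rw [show returnBound N m = p * (x + 1) * (2 * x) / N from rfl]
    ring
  rw [e]
  exact mul_le_mul_of_nonneg_right hmain (by positivity)

theorem dmTV_eq_zero_of_isEmpty {ι : Type*} [IsEmpty ι] (μ ν : Measure (ι → ℕ))
    [IsProbabilityMeasure μ] [IsProbabilityMeasure ν] : dmTV μ ν ≤ 0 := by
  refine ciSup_le fun B => ?_
  rcases Set.eq_empty_or_nonempty B with rfl | hB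
  · simp
  · rw [Subsingleton.eq_univ_of_nonempty hB]
    simp

end Main

theorem mainTheorem1 (N : ℕ) (hN : 1 ≤ N) (W : Finset WordClass) (hW : maxLength W ≤ N) :
    dmTV ((gluingMeasure N).map (countVector W N)) (poissonVector W) ≤
      18 * (W.card : ℝ) ^ 3 * (6 * (maxLength W : ℝ)) ^ (3 * maxLength W + 4) * (1 / (N : ℝ)) := by
  have := isProbabilityMeasure_gluingMeasure N
  have : IsProbabilityMeasure ((gluingMeasure N).map (countVector W N)) :=
    Measure.isProbabilityMeasure_map Measurable.of_discrete.aemeasurable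
  have : IsProbabilityMeasure (poissonVector W) := by
    unfold poissonVector; infer_instance
  obtain rfl | ⟨c, hc⟩ := W.eq_empty_or_nonempty
  · exact (dmTV_eq_zero_of_isEmpty _ _).trans (by simp)
  have hlen : ∀ c ∈ W, c.length ≤ maxLength W := fun c hc => Finset.le_sup (f := WordClass.length) hc
  have hm : 1 ≤ maxLength W := (length_pos c).trans_le (hlen c hc)
  have hv : (1 : ℝ) ≤ W.card := by exact_mod_cast Finset.card_pos.2 ⟨c, hc⟩
  set m := maxLength W
  by_cases hlarge : 2 * m ≤ N ∧ m ^ 2 ≤ N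
  · exact (dmTV_le_of_large hm hlarge.1 hlarge.2 hlen).trans (error_le hm hN hv)
  · refine (dmTV_le_one _ _).trans ?_
    have hm' : (1 : ℝ) ≤ m := by exact_mod_cast hm
    have hN' : (1 : ℝ) ≤ N := by exact_mod_cast hN
    have h1 : (N : ℝ) ≤ 2 * m ^ 2 := by
      have : N ≤ 2 * m ^ 2 := by
        by_contra hcon
        push Not at hcon
        exact hlarge ⟨by nlinarith, by nlinarith⟩
      exact_mod_cast this
    have h2 : (6 * (m : ℝ)) ^ 2 ≤ (6 * (m : ℝ)) ^ (3 * m + 4) :=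
      pow_le_pow_right₀ (by linarith) (by omega)
    have h3 : (1 : ℝ) ≤ (W.card : ℝ) ^ 3 := one_le_pow₀ hv
    rw [mul_one_div, le_div_iff₀ (by linarith), one_mul]
    calc (N : ℝ) ≤ 18 * 1 * (6 * (m : ℝ)) ^ 2 := by nlinarith
      _ ≤ 18 * (W.card : ℝ) ^ 3 * (6 * (m : ℝ)) ^ (3 * m + 4) := by gcongr
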